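/- Let $k$ be a field and $H$ a (not necessarily finite-dimensional) Hopf algebra over $k$ with comultiplication $\Delta(h)=h_1\otimes h_2$, counit $\varepsilon$ and antipode $S$; let $*$ denote the convolution product on $H^*$, with unit $\varepsilon$. Assume that $H$ is co-Frobenius, i.e. the rational part $H^{*\mathrm{rat}}$ of the left $H^*$-module $H^*$ is nonzero. Let $\int_l^{H^*}=\{\lambda\in H^* : p*\lambda=p(1)\lambda \text{ for all } p\in H^*\}$ be the space of left integrals. There is a unique grouplike element $a\in G(H)$ with $\lambda(h_1)h_2=\lambda(h)a^{-1}$ for all $\lambda\in\int_l^{H^*}$, $h\in H$, and a unique algebra automorphism $\chi$ of $H$ with $\lambda(mh)=\lambda(\chi(h)m)$ for all $\lambda\in\int_l^{H^*}$, $h,m\in H$. Put $\alpha=\varepsilon\circ\chi$, an algebra map $H\to k$. The elements $a$ and $\alpha$ are the modular elements of $H$ in $H$ and in $H^*$. Let $\sigma:H\otimes H\to k$ be a coquasitriangular structure on $H$, i.e. a linear map such that for all $h,l,m\in H$ $$\sigma(hl,m)=\sigma(h,m_1)\sigma(l,m_2),\qquad \sigma(h,lm)=\sigma(h_1,m)\sigma(h_2,l),$$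 $$\sigma(h,1)=\sigma(1,h)=\varepsilon(h),\qquad l_1h_1\,\sigma(h_2,l_2)=\sigma(h_1,l_1)\,h_2l_2 .$$ Put $u(h)=\sigma(h_2,S(h_1))$, and for $g\in G(H)$ let $\alpha_g=\sigma(-,g^{-1})$ and $\beta_g=\sigma(g,-)$, which are algebra maps $H\to k$. Then $u$ and $\alpha$ are invertible in the convolution algebra $H^*$ (inverses below are convolution inverses), and: (i) $\alpha_a=\beta_a$. (ii) If $a=1$, then $u^{-1}*(u\circ S)=\alpha$; in particular $u^{-1}*(u\circ S)$ is the same for every coquasitriangular structure $\sigma$ on $H$. (iii) $u\circ S=u$ if and only if $\alpha_a=\alpha^{-1}$. -/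

import Mathlib

open scoped TensorProduct
open WithConv

noncomputable section

namespace CoFrobenius

variable (k H : Type*) [Field k] [Ring H] [HopfAlgebra k H]

/-- The rational part of the dual `H^*`, seen as a left module over the convolution algebra `H^*`:
a functional `f` is rational if there is a finite sum `t = ∑ fᵢ ⊗ hᵢ` in `H^* ⊗ H` with
`p * f = ∑ p(hᵢ) fᵢ` for all `p` in `H^*`. -/
def rationalDual : Submodule k (Module.Dual k H) where
  carrier := {f | ∃ t : Module.Dual k H ⊗[k] H, ∀ p : Module.Dual k H,
    (toConv p * toConv f).ofConv =
      TensorProduct.rid k (Module.Dual k H) (p.lTensor (Module.Dual k H) t)}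
  add_mem' := by
    rintro f g ⟨s, hs⟩ ⟨t, ht⟩
    refine ⟨s + t, fun p => ?_⟩
    rw [toConv_add, mul_add, ofConv_add, hs, ht, map_add, map_add]
  zero_mem' := ⟨0, fun p => by simp⟩
  smul_mem' := by
    rintro c f ⟨t, ht⟩
    refine ⟨c • t, fun p => ?_⟩
    rw [toConv_smul, mul_smul_comm, ofConv_smul, ht, map_smul, map_smul]

/-- `H` is co-Frobenius if the rational part of `H^*` is nonzero. -/
def IsCoFrobenius : Prop := rationalDual k H ≠ ⊥

/-- The space of left integrals for `H` in `H^*`: the functionals `l` with `p * l = p(1) l`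
for all `p` in `H^*`, where `*` is convolution. -/
def leftIntegral : Submodule k (Module.Dual k H) where
  carrier := {l | ∀ p : Module.Dual k H, toConv p * toConv l = p 1 • toConv l}
  add_mem' := by
    intro f g hf hg p
    rw [toConv_add, mul_add, hf, hg, smul_add]
  zero_mem' := fun p => by simp
  smul_mem' := by
    intro c f hf p
    rw [toConv_smul, mul_smul_comm, hf, smul_comm]

variable {k H}

/-- `a` is the modular (distinguished grouplike) element of `H`:
`l(h₁) h₂ = l(h) a⁻¹` for all left integrals `l` and all `h` in `H`. -/
def IsModularElement (a : GroupLike k H) : Prop :=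
  ∀ l ∈ leftIntegral k H, ∀ h : H,
    TensorProduct.lid k H (LinearMap.rTensor H l (Coalgebra.comul (R := k) h)) =
      l h • ((a⁻¹ : GroupLike k H) : H)

/-- `χ` is the generalized Frobenius automorphism of `H`: `h ⇀ l = l ↼ χ(h)`, that is
`l(m h) = l(χ(h) m)` for all `h, m` in `H`, for all left integrals `l`. -/
def IsFrobeniusAut (χ : H ≃ₐ[k] H) : Prop :=
  ∀ l ∈ leftIntegral k H, ∀ h m : H, l (m * h) = l (χ h * m)

/-- The functional `ε ∘ χ`. For the generalized Frobenius automorphism `χ` it is the modular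
element of `H` in `H^*`. -/
def counitComp (χ : H ≃ₐ[k] H) : H →ₐ[k] k :=
  (Bialgebra.counitAlgHom k H).comp (χ : H →ₐ[k] H)

/-- An algebra map `H → k`, as an element of the convolution algebra `H^*`. -/
def toDual (f : H →ₐ[k] k) : WithConv (H →ₗ[k] k) := toConv f.toLinearMap

variable (k H)

/-- A coquasitriangular structure `σ : H ⊗ H → k` on the Hopf algebra `H`. The products
of slices of `σ` in the first two axioms are convolution products of functionals on `H`. -/
structure Coquasitriangular where
  /-- The bilinear form `σ`. -/
  form : H ⊗[k] H →ₗ[k] k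
  /-- `σ(hl, m) = σ(h, m₁) σ(l, m₂)`. -/
  form_mul_left : ∀ h l : H,
    toConv (TensorProduct.curry form (h * l)) =
      toConv (TensorProduct.curry form h) * toConv (TensorProduct.curry form l)
  /-- `σ(h, lm) = σ(h₁, m) σ(h₂, l)`. -/
  form_mul_right : ∀ l m : H,
    toConv ((TensorProduct.curry form).flip (l * m)) =
      toConv ((TensorProduct.curry form).flip m) * toConv ((TensorProduct.curry form).flip l)
  /-- `σ(h, 1) = ε(h)`. -/
  form_one_right : ∀ h : H, form (h ⊗ₜ[k] 1) = Coalgebra.counit (R := k) h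
  /-- `σ(1, h) = ε(h)`. -/
  form_one_left : ∀ h : H, form (1 ⊗ₜ[k] h) = Coalgebra.counit (R := k) h
  /-- `l₁ h₁ σ(h₂, l₂) = σ(h₁, l₁) h₂ l₂`; here `comul` is the comultiplication of `H ⊗ H`,
  which sends `h ⊗ l` to `(h₁ ⊗ l₁) ⊗ (h₂ ⊗ l₂)`. -/
  mul_comm_form : ∀ h l : H,
    TensorProduct.rid k H
        (TensorProduct.map
          (LinearMap.mul' k H ∘ₗ (TensorProduct.comm k H H).toLinearMap) form
          (Coalgebra.comul (R := k) (h ⊗ₜ[k] l))) =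
      TensorProduct.lid k H
        (TensorProduct.map form (LinearMap.mul' k H)
          (Coalgebra.comul (R := k) (h ⊗ₜ[k] l)))

variable {k H}

namespace Coquasitriangular

variable (σ : Coquasitriangular k H)

/-- `u(h) = σ(h₂, S(h₁))`. -/
def u : H →ₗ[k] k :=
  σ.form ∘ₗ (TensorProduct.comm k H H).toLinearMap ∘ₗ
    LinearMap.rTensor H (HopfAlgebra.antipode k) ∘ₗ Coalgebra.comul

/-- `v = u ∘ S`. -/
def v : H →ₗ[k] k := σ.u ∘ₗ HopfAlgebra.antipode k

/-- The algebra map `α_g = σ(-, g⁻¹)` for a grouplike element `g`. -/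
def alphaOf (g : GroupLike k H) : H →ₐ[k] k :=
  AlgHom.ofLinearMap ((TensorProduct.curry σ.form).flip ((g⁻¹ : GroupLike k H) : H))
    (by
      have hg : IsGroupLikeElem k ((g⁻¹ : GroupLike k H) : H) := (g⁻¹).isGroupLikeElem_val
      simpa only [LinearMap.flip_apply, TensorProduct.curry_apply, hg.counit_eq_one]
        using σ.form_one_left ((g⁻¹ : GroupLike k H) : H))
    (by
      intro h l
      have hg : IsGroupLikeElem k ((g⁻¹ : GroupLike k H) : H) := (g⁻¹).isGroupLikeElem_val
      have e := congrArg (fun f => f ((g⁻¹ : GroupLike k H) : H)) (σ.form_mul_left h l)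
      simp only [LinearMap.convMul_apply, hg.comul_eq_tmul_self, TensorProduct.map_tmul,
        LinearMap.mul'_apply] at e
      simpa only [LinearMap.flip_apply] using e)

/-- The algebra map `β_g = σ(g, -)` for a grouplike element `g`. -/
def betaOf (g : GroupLike k H) : H →ₐ[k] k :=
  AlgHom.ofLinearMap (TensorProduct.curry σ.form (g : H))
    (by
      have hg : IsGroupLikeElem k (g : H) := g.isGroupLikeElem_val
      simpa only [TensorProduct.curry_apply, hg.counit_eq_one] using σ.form_one_right (g : H))
    (by
      intro l m
      have hg : IsGroupLikeElem k (g : H) := g.isGroupLikeElem_val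
      have e := congrArg (fun f => f (g : H)) (σ.form_mul_right l m)
      simp only [LinearMap.convMul_apply, hg.comul_eq_tmul_self, TensorProduct.map_tmul,
        LinearMap.mul'_apply, LinearMap.flip_apply] at e
      rw [e, mul_comm])

end Coquasitriangular

end CoFrobenius

end

noncomputable section

namespace CoFrobenius

-- Write v = u ∘ S and b = a⁻¹. The theorem rests on one identity, v * β_b = u * α (`v_mul_betaOf`).
-- Apply a nonzero left integral l to the commutation axiom of σ. The translation formulas for l
-- rewrite both sides, nondegeneracy of l removes the test element, and the counit leaves σ(S⁻¹(m₁)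
-- b, m₂) = u(χ(m)). The left side is (v * β_b)(m) since σ(S⁻¹x, y) = σ(x, Sy). The right side is (u
-- * α)(m) since χ(h) = S⁻²(h₁) α(h₂) and u ∘ S² = u. Hence v = u * α * β_a (`v_eq`).
--
-- For (i), use the same identity for the reversed structure σ'(h, l) = σ(S(l), h), for which v' =
-- u⁻¹ and u' = v⁻¹. It gives v * u⁻¹ = α * β'_a. As u and v commute, also v * u⁻¹ = u⁻¹ * v = α *
-- β_a. Cancelling α gives β_a = β'_a, and β'_a = α_a because σ is invariant under S ⊗ S. So u⁻¹ * v
-- = α * α_a, from which (ii) and (iii) are read off.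
--
-- The rest is the theory of integrals without finiteness. A Hopf-module projection of a rational
-- functional yields a nonzero integral (`exists_leftIntegral_ne_zero`); then S is bijective, the
-- form l(hm) is nondegenerate on both sides, and integrals are unique up to scalar, which produces
-- a and χ. A recurring device: an integral formula places Δ(h) in N ⊗ H or H ⊗ N, with N the common
-- kernel of a family of functionals, and one evaluates an expression that vanishes on N.

attribute [fun_prop] IsLinearMap

/-! ### Linearity in a form `fun_prop` can check, for the side conditions of the Sweedler calculus.
-/

section Linearity

variable {k V W M A : Type*} [CommSemiring k] [AddCommMonoid V] [Module k V] [AddCommMonoid W]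
  [Module k W] [AddCommMonoid M] [Module k M] [Semiring A] [Algebra k A]

@[fun_prop]
theorem isLinearMap_id : IsLinearMap k (fun x : V => x) := ⟨fun _ _ => rfl, fun _ _ => rfl⟩

@[fun_prop]
theorem isLinearMap_comp {f : W → M} {g : V → W} (hf : IsLinearMap k f) (hg : IsLinearMap k g) :
    IsLinearMap k (fun x => f (g x)) :=
  ⟨fun x y => by rw [hg.map_add, hf.map_add], fun c x => by rw [hg.map_smul, hf.map_smul]⟩

@[fun_prop]
theorem isLinearMap_coe (T : V →ₗ[k] W) : IsLinearMap k (fun x => T x) := T.isLinear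

@[fun_prop]
theorem isLinearMap_mul_const {f : V → A} (hf : IsLinearMap k f) (a : A) :
    IsLinearMap k (fun x => f x * a) :=
  ⟨fun x y => by rw [hf.map_add, add_mul], fun c x => by rw [hf.map_smul, smul_mul_assoc]⟩

@[fun_prop]
theorem isLinearMap_const_mul {f : V → A} (hf : IsLinearMap k f) (a : A) :
    IsLinearMap k (fun x => a * f x) :=
  ⟨fun x y => by rw [hf.map_add, mul_add], fun c x => by rw [hf.map_smul, mul_smul_comm]⟩

@[fun_prop]
theorem isLinearMap_smul_const {f : V → k} (hf : IsLinearMap k f) (m : M) :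
    IsLinearMap k (fun x => f x • m) :=
  ⟨fun x y => by rw [hf.map_add, add_smul], fun c x => by rw [hf.map_smul, smul_assoc]⟩

@[fun_prop]
theorem isLinearMap_const_smul {f : V → M} (hf : IsLinearMap k f) (c : k) :
    IsLinearMap k (fun x => c • f x) :=
  ⟨fun x y => by rw [hf.map_add, smul_add], fun d x => by rw [hf.map_smul, smul_comm]⟩

@[fun_prop]
theorem isLinearMap_tmul_const {f : V → M} (hf : IsLinearMap k f) (w : W) :
    IsLinearMap k (fun x => f x ⊗ₜ[k] w) :=
  ⟨fun x y => by rw [hf.map_add, TensorProduct.add_tmul],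
    fun d x => by rw [hf.map_smul, TensorProduct.smul_tmul']⟩

@[fun_prop]
theorem isLinearMap_const_tmul {f : V → M} (hf : IsLinearMap k f) (w : W) :
    IsLinearMap k (fun x => w ⊗ₜ[k] f x) :=
  ⟨fun x y => by rw [hf.map_add, TensorProduct.tmul_add],
    fun d x => by rw [hf.map_smul, TensorProduct.tmul_smul]⟩

@[fun_prop]
theorem isLinearMap_sum {ι : Type*} {s : Finset ι} {f : V → ι → M}
    (hf : ∀ i, IsLinearMap k (fun x => f x i)) : IsLinearMap k (fun x => ∑ i ∈ s, f x i) :=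
  ⟨fun x y => by simp only [(hf _).map_add, Finset.sum_add_distrib],
    fun d x => by simp only [(hf _).map_smul, Finset.smul_sum]⟩

end Linearity

/-! ### Sweedler calculus. -/

section Sweedler

variable (k : Type*) {H M N : Type*} [CommSemiring k] [AddCommMonoid M] [Module k M]
  [AddCommMonoid N] [Module k N]

open Coalgebra in
/-- The Sweedler sum `f(h₁, h₂)`. It is meaningful for bilinear `f`. -/
def sw [AddCommMonoid H] [Module k H] [Coalgebra k H] (h : H) (f : H → H → M) : M :=
  ∑ i ∈ (ℛ k h).index, f ((ℛ k h).left i) ((ℛ k h).right i)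

variable {k}

section Coalgebra

variable [AddCommMonoid H] [Module k H] [Coalgebra k H]

omit [Module k M] in
theorem sw_congr {f g : H → H → M} (e : ∀ x y, f x y = g x y) (h : H) : sw k h f = sw k h g := by
  simp only [sw, e]

theorem map_sw (T : M →ₗ[k] N) (h : H) (f : H → H → M) :
    T (sw k h f) = sw k h fun x y => T (f x y) := by
  simp only [sw, map_sum]

theorem map_sw_of_isLinearMap {T : M → N} (hT : IsLinearMap k T) (h : H) (f : H → H → M) :
    T (sw k h f) = sw k h fun x y => T (f x y) :=
  map_sw (hT.mk' T) h f

omit [Module k M] in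
theorem sw_comm (h m : H) (f : H → H → H → H → M) :
    (sw k h fun a b => sw k m fun c d => f a b c d) =
      sw k m fun c d => sw k h fun a b => f a b c d := by
  simp only [sw]
  exact Finset.sum_comm

omit [Module k M] in
theorem sw_sum {ι : Type*} (s : Finset ι) (h : H) (f : ι → H → H → M) :
    (sw k h fun x y => ∑ i ∈ s, f i x y) = ∑ i ∈ s, sw k h fun x y => f i x y := by
  simp only [sw]
  exact Finset.sum_comm

/-- The linear map on `H ⊗ H` corresponding to a bilinear function. -/
def bilin {V W : Type*} [AddCommMonoid V] [Module k V] [AddCommMonoid W] [Module k W]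
    (f : V → W → M) (h1 : ∀ y, IsLinearMap k fun x => f x y)
    (h2 : ∀ x, IsLinearMap k fun y => f x y) : V ⊗[k] W →ₗ[k] M :=
  TensorProduct.lift (LinearMap.mk₂ k f (fun a b y => (h1 y).map_add a b)
    (fun c a y => (h1 y).map_smul c a) (fun x a b => (h2 x).map_add a b)
    (fun c x a => (h2 x).map_smul c a))

@[simp]
theorem bilin_tmul {V W : Type*} [AddCommMonoid V] [Module k V] [AddCommMonoid W] [Module k W]
    (f : V → W → M) (h1 : ∀ y, IsLinearMap k fun x => f x y)
    (h2 : ∀ x, IsLinearMap k fun y => f x y) (x : V) (y : W) :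
    bilin f h1 h2 (x ⊗ₜ y) = f x y := by simp [bilin]

/-- `sw` sums over a chosen representative of Δ(h); for bilinear `f` the value depends on Δ(h)
alone. -/
theorem sw_eq_bilin {f : H → H → M} (h1 : ∀ y, IsLinearMap k fun x => f x y)
    (h2 : ∀ x, IsLinearMap k fun y => f x y) (h : H) :
    sw k h f = bilin f h1 h2 (Coalgebra.comul h) := by
  simp [sw, ← (Coalgebra.Repr.arbitrary k h).eq, map_sum]

theorem sw_tmul (h : H) : (sw k h fun x y => x ⊗ₜ[k] y) = Coalgebra.comul h :=
  (Coalgebra.Repr.arbitrary k h).eq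

theorem map_comul {M : Type*} [AddCommMonoid M] [Module k M] (T : H ⊗[k] H →ₗ[k] M) (h : H) :
    T (Coalgebra.comul h) = sw k h fun x y => T (x ⊗ₜ y) := by
  rw [← sw_tmul, map_sw]

theorem sw_mul_sw {A : Type*} [Semiring A] (h m : H) (f g : H → H → A) :
    sw k h f * sw k m g = sw k h fun a b => sw k m fun c d => f a b * g c d := by
  simp only [sw, Finset.sum_mul_sum]

theorem convMul_apply_eq_sw {A : Type*} [Semiring A] [Algebra k A] (f g : WithConv (H →ₗ[k] A))
    (h : H) : (f * g) h = sw k h fun x y => f x * g y := by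
  rw [LinearMap.convMul_apply, map_comul, map_sw]
  simp only [TensorProduct.map_tmul, LinearMap.mul'_apply]

@[fun_prop]
theorem isLinearMap_sw_left {V : Type*} [AddCommMonoid V] [Module k V] {g : V → H} {f : H → H → M}
    (hg : IsLinearMap k g) (h1 : ∀ y, IsLinearMap k fun x => f x y)
    (h2 : ∀ x, IsLinearMap k fun y => f x y) :
    IsLinearMap k (fun v => sw k (g v) f) := by
  simp only [sw_eq_bilin h1 h2]
  fun_prop

@[fun_prop]
theorem isLinearMap_sw_right {V : Type*} [AddCommMonoid V] [Module k V] {h : H} {f : V → H → H → M}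
    (hf : ∀ x y, IsLinearMap k fun v => f v x y) :
    IsLinearMap k (fun v => sw k h (f v)) := by
  simp only [sw]
  fun_prop

theorem sw_counit_left {f : H → M} (hf : IsLinearMap k f) (h : H) :
    (sw k h fun x y => Coalgebra.counit (R := k) x • f y) = f h := by
  conv_rhs => rw [← Coalgebra.sum_counit_smul (Coalgebra.Repr.arbitrary k h)]
  rw [← hf.mk'_apply, map_sum]
  simp [sw]

theorem sw_counit_right {f : H → M} (hf : IsLinearMap k f) (h : H) :
    (sw k h fun x y => Coalgebra.counit (R := k) y • f x) = f h := by
  have := congrArg (bilin (fun x (y : k) => y • f x) (by fun_prop) (by fun_prop))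
    (Coalgebra.sum_tmul_counit_eq (Coalgebra.Repr.arbitrary k h))
  simpa only [map_sum, bilin_tmul, one_smul, sw] using this

theorem sw_assoc {f : H → H → H → M} (h1 : ∀ y z, IsLinearMap k fun x => f x y z)
    (h2 : ∀ x z, IsLinearMap k fun y => f x y z) (h3 : ∀ x y, IsLinearMap k fun z => f x y z)
    (h : H) :
    (sw k h fun x z => sw k x fun a b => f a b z) = sw k h fun a y => sw k y fun b z => f a b z := by
  let T : H ⊗[k] (H ⊗[k] H) →ₗ[k] M :=
    bilin (fun x (t : H ⊗[k] H) => bilin (f x) (h2 x) (h3 x) t)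
      (fun t => by
        induction t with
        | zero => exact ⟨fun a b => by simp, fun c a => by simp⟩
        | tmul x y => simpa using h1 x y
        | add x y hx hy =>
          refine ⟨fun a b => ?_, fun c a => ?_⟩
          · simp only [map_add, hx.map_add, hy.map_add]; abel
          · simp only [map_add, hx.map_smul, hy.map_smul, smul_add]) (by fun_prop)
  have hT : ∀ a b z, T (a ⊗ₜ (b ⊗ₜ z)) = f a b z := fun a b z => by simp [T]
  let U : (H ⊗[k] H) ⊗[k] H →ₗ[k] M := T ∘ₗ (TensorProduct.assoc k H H H).toLinearMap
  have hl : ∀ x z, (sw k x fun a b => f a b z) = U (Coalgebra.comul x ⊗ₜ z) := fun x z => by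
    have : IsLinearMap k fun t : H ⊗[k] H => U (t ⊗ₜ z) := by fun_prop
    rw [← sw_tmul, map_sw_of_isLinearMap this]
    simp [U, hT]
  have hr : ∀ x y, (sw k y fun b z => f x b z) = T (x ⊗ₜ Coalgebra.comul y) := fun x y => by
    have : IsLinearMap k fun t : H ⊗[k] H => T (x ⊗ₜ t) := by fun_prop
    rw [← sw_tmul, map_sw_of_isLinearMap this]
    simp [hT]
  simp only [hl, hr]
  have a := map_comul (U ∘ₗ Coalgebra.comul.rTensor H) h
  have b := map_comul (T ∘ₗ Coalgebra.comul.lTensor H) h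
  simp only [LinearMap.comp_apply, LinearMap.rTensor_tmul, LinearMap.lTensor_tmul] at a b
  rw [← a, ← b]
  exact congrArg T (Coalgebra.coassoc_apply (R := k) h)

/-- Cancellation of the first two of three Sweedler components. -/
theorem sw_cancel_left {φ : H → H → N} {c : N}
    (hφ : ∀ h, sw k h φ = Coalgebra.counit (R := k) h • c)
    (φ1 : ∀ y, IsLinearMap k fun x => φ x y) (φ2 : ∀ x, IsLinearMap k fun y => φ x y)
    (G : N → H → M) (G1 : ∀ y, IsLinearMap k fun x => G x y) (G2 : ∀ x, IsLinearMap k fun y => G x y)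
    (h : H) : (sw k h fun x y => sw k y fun p q => G (φ x p) q) = G c h := by
  rw [← sw_assoc (f := fun x p q => G (φ x p) q) (by fun_prop) (by fun_prop) (by fun_prop)]
  have : ∀ x q, (sw k x fun a b => G (φ a b) q) = Coalgebra.counit (R := k) x • G c q :=
    fun x q => by rw [← map_sw_of_isLinearMap (G1 q), hφ, (G1 q).map_smul]
  simp only [this]
  exact sw_counit_left (G2 c) h

/-- Cancellation of the last two of three Sweedler components. -/
theorem sw_cancel_right {φ : H → H → N} {c : N}
    (hφ : ∀ h, sw k h φ = Coalgebra.counit (R := k) h • c)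
    (G : H → N → M) (G1 : ∀ y, IsLinearMap k fun x => G x y) (G2 : ∀ x, IsLinearMap k fun y => G x y)
    (h : H) : (sw k h fun x y => sw k y fun p q => G x (φ p q)) = G h c := by
  have : ∀ x y, (sw k y fun a b => G x (φ a b)) = Coalgebra.counit (R := k) y • G x c :=
    fun x q => by rw [← map_sw_of_isLinearMap (G2 x), hφ, (G2 x).map_smul]
  simp only [this]
  exact sw_counit_right (G1 c) h

theorem sw_swap_assoc {G : H → H → H → H → M}
    (h1 : ∀ q c d, IsLinearMap k fun p => G p q c d)
    (h2 : ∀ p c d, IsLinearMap k fun q => G p q c d)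
    (h3 : ∀ p q d, IsLinearMap k fun c => G p q c d)
    (h4 : ∀ p q c, IsLinearMap k fun d => G p q c d) (x : H) :
    (sw k x fun a b => sw k b fun c d => sw k a fun p q => G p q c d) =
      sw k x fun p r => sw k r fun q b => sw k b fun c d => G p q c d := by
  rw [← sw_assoc (f := fun p q b => sw k b fun c d => G p q c d) (by fun_prop) (by fun_prop)
    (by fun_prop)]
  exact sw_congr (fun a b => sw_comm _ _ _) x

end Coalgebra

section Bialgebra

variable [Semiring H] [Bialgebra k H] {f : H → H → M}

theorem sw_mul (h1 : ∀ y, IsLinearMap k fun x => f x y) (h2 : ∀ x, IsLinearMap k fun y => f x y)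
    (a b : H) :
    sw k (a * b) f = sw k a fun x y => sw k b fun p q => f (x * p) (y * q) := by
  rw [sw_eq_bilin h1 h2, Bialgebra.comul_mul, ← sw_tmul a, ← sw_tmul b]
  have e : IsLinearMap k fun t : H ⊗[k] H => bilin f h1 h2 (t * sw k b fun x y => x ⊗ₜ[k] y) := by
    fun_prop
  rw [map_sw_of_isLinearMap e]
  congr 1
  ext x y
  have e : IsLinearMap k fun t : H ⊗[k] H => bilin f h1 h2 (x ⊗ₜ[k] y * t) := by
    fun_prop
  rw [map_sw_of_isLinearMap e]
  simp

theorem sw_groupLike (h1 : ∀ y, IsLinearMap k fun x => f x y)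
    (h2 : ∀ x, IsLinearMap k fun y => f x y) {g : H} (hg : IsGroupLikeElem k g) :
    sw k g f = f g g := by
  rw [sw_eq_bilin h1 h2, hg.comul_eq_tmul_self, bilin_tmul]

end Bialgebra

section Hopf

variable [Semiring H] [HopfAlgebra k H] {f : H → H → M}

open HopfAlgebra Coalgebra

theorem sw_antipode_mul (h : H) :
    (sw k h fun x y => antipode k x * y) = counit (R := k) h • (1 : H) :=
  sum_antipode_mul_eq_smul _

theorem sw_mul_antipode (h : H) :
    (sw k h fun x y => x * antipode k y) = counit (R := k) h • (1 : H) :=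
  sum_mul_antipode_eq_smul _

theorem sw_antipode_antipode_mul (h : H) :
    (sw k h fun x y => antipode k (antipode k y) * antipode k x) = counit (R := k) h • (1 : H) := by
  simp only [← antipode_mul_antidistrib]
  rw [← map_sw, sw_mul_antipode, map_smul, antipode_one]

theorem sw_antipode_mul_antipode (h : H) :
    (sw k h fun x y => antipode k y * antipode k (antipode k x)) = counit (R := k) h • (1 : H) := by
  simp only [← antipode_mul_antidistrib]
  rw [← map_sw, sw_antipode_mul, map_smul, antipode_one]

/-- Both sides are convolution inverses of Δ in Hom(H, H ⊗ H). -/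
theorem comul_antipode (h : H) :
    comul (R := k) (antipode k h) = sw k h fun x y => antipode k y ⊗ₜ[k] antipode k x := by
  let G : H →ₗ[k] H ⊗[k] H :=
    TensorProduct.map (antipode k) (antipode k) ∘ₗ (TensorProduct.comm k H H).toLinearMap ∘ₗ comul
  have hG : ∀ h, G h = sw k h fun x y => antipode k y ⊗ₜ[k] antipode k x := fun h => by
    simp [G, LinearMap.comp_apply, map_comul, map_sw]
  have : toConv G * toConv (comul (R := k) (A := H)) = 1 := by
    ext h
    rw [LinearMap.convMul_apply, map_comul, map_sw]
    calc _ = sw k h fun x y => sw k x fun a b => sw k y fun c d =>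
          (antipode k b * c) ⊗ₜ[k] (antipode k a * d) := by
          simp only [TensorProduct.map_tmul, LinearMap.mul'_apply, hG]
          simp only [← sw_tmul, sw_mul_sw, Algebra.TensorProduct.tmul_mul_tmul]
      _ = sw k h fun a y => sw k y fun b y => sw k y fun c d =>
          (antipode k b * c) ⊗ₜ[k] (antipode k a * d) :=
          sw_assoc (by fun_prop) (by fun_prop) (by fun_prop) h
      _ = sw k h fun a y => 1 ⊗ₜ[k] (antipode k a * y) := by
          congr! with a y
          exact sw_cancel_left sw_antipode_mul (by fun_prop) (by fun_prop)
            (fun c d => c ⊗ₜ[k] (antipode k a * d)) (by fun_prop) (by fun_prop) y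
      _ = _ := by
          have e : IsLinearMap k fun t : H => (1 : H) ⊗ₜ[k] t := by fun_prop
          rw [← map_sw_of_isLinearMap e, sw_antipode_mul, LinearMap.convOne_apply,
            Algebra.algebraMap_eq_smul_one, e.map_smul]
          rfl
  have e := left_inv_eq_right_inv this (LinearMap.comul_right_inv (R := k) (C := H))
  rw [← hG]
  exact (congrArg (fun f => f.ofConv h) e).symm

theorem sw_antipode (h1 : ∀ y, IsLinearMap k fun x => f x y)
    (h2 : ∀ x, IsLinearMap k fun y => f x y) (h : H) :
    sw k (antipode k h) f = sw k h fun x y => f (antipode k y) (antipode k x) := by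
  rw [sw_eq_bilin h1 h2, comul_antipode, map_sw]
  simp

end Hopf

end Sweedler
-- Translation formulas for left and right integrals.
section Integrals

variable {k H : Type*} [Field k] [Ring H] [HopfAlgebra k H]

open HopfAlgebra Coalgebra

local notation "𝑺" => antipode k (A := H)

theorem mem_leftIntegral_iff {l : Module.Dual k H} :
    l ∈ leftIntegral k H ↔ ∀ h, (sw k h fun x y => l y • x) = l h • (1 : H) := by
  have key : ∀ (p : Module.Dual k H) h,
      (toConv p * toConv l) h = p (sw k h fun x y => l y • x) := fun p h => by
    simp only [convMul_apply_eq_sw, map_sw, map_smul, smul_eq_mul, mul_comm (l _)]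
  constructor
  · intro hl h
    rw [← sub_eq_zero, ← Module.forall_dual_apply_eq_zero_iff k]
    intro p
    have := congrArg (fun f => f h) (hl p)
    simp only [key] at this
    rw [map_sub, this]
    simp [mul_comm]
  · intro hl p
    ext h
    rw [key, hl]
    simp [mul_comm]

/-- Right integrals in `H^*`: functionals with `r(h₁) h₂ = r(h) 1`. -/
def IsRightIntegral (r : Module.Dual k H) : Prop :=
  ∀ h, (sw k h fun x y => r x • y) = r h • (1 : H)

variable {l r : Module.Dual k H}

/-- Apply the integral property to h S(m₁) and multiply by m₂: the antipode cancels the surplus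
factor from Δ(S(m₁)). The next two formulas are proved in the same way. -/
theorem leftIntegral_mul_antipode (hl : l ∈ leftIntegral k H) (h m : H) :
    (sw k h fun x y => l (y * 𝑺 m) • x) = sw k m fun p q => l (h * 𝑺 p) • q := by
  symm
  calc (sw k m fun p q => l (h * 𝑺 p) • q)
      = sw k m fun p q => (sw k (h * 𝑺 p) fun x y => l y • x) * q := by
        simp [mem_leftIntegral_iff.1 hl]
    _ = sw k m fun p q => sw k p fun p p' => sw k h fun x y => l (y * 𝑺 p) • (x * (𝑺 p' * q)) := by
        congr! 3 with p q
        rw [sw_mul (by fun_prop) (by fun_prop)]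
        simp (disch := fun_prop) only [sw_antipode]
        rw [sw_comm]
        have e : IsLinearMap k fun z => z * q := by fun_prop
        simp only [map_sw_of_isLinearMap e]
        simp [mul_assoc]
    _ = sw k m fun p q => sw k q fun p' q => sw k h fun x y => l (y * 𝑺 p) • (x * (𝑺 p' * q)) :=
        sw_assoc (by fun_prop) (by fun_prop) (by fun_prop) m
    _ = sw k h fun x y => l (y * 𝑺 m) • (x * 1) :=
        sw_cancel_right sw_antipode_mul
          (fun p z => sw k h fun x y => l (y * 𝑺 p) • (x * z)) (by fun_prop) (by fun_prop) m
    _ = _ := by simp only [mul_one]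

theorem leftIntegral_mul (hl : l ∈ leftIntegral k H) (h m : H) :
    (sw k h fun x y => l (m * y) • x) = sw k m fun p q => l (q * h) • 𝑺 p := by
  symm
  calc (sw k m fun p q => l (q * h) • 𝑺 p)
      = sw k m fun p q => 𝑺 p * (sw k (q * h) fun x y => l y • x) := by
        simp [mem_leftIntegral_iff.1 hl]
    _ = sw k m fun p q => sw k q fun c d => sw k h fun x y => l (d * y) • (𝑺 p * c * x) := by
        congr! 3 with p q
        rw [sw_mul (by fun_prop) (by fun_prop)]
        have e : IsLinearMap k fun z => 𝑺 p * z := by fun_prop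
        simp only [map_sw_of_isLinearMap e]
        simp [mul_assoc]
    _ = sw k h fun x y => l (m * y) • (1 * x) :=
        sw_cancel_left sw_antipode_mul (by fun_prop) (by fun_prop)
          (fun z d => sw k h fun x y => l (d * y) • (z * x)) (by fun_prop) (by fun_prop) m
    _ = _ := by simp only [one_mul]

theorem IsRightIntegral.mul (hr : IsRightIntegral r) (h m : H) :
    (sw k h fun x y => r (x * m) • y) = sw k m fun p q => r (h * p) • 𝑺 q := by
  symm
  calc (sw k m fun p q => r (h * p) • 𝑺 q)
      = sw k m fun p q => (sw k (h * p) fun x y => r x • y) * 𝑺 q := by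
        simp [hr _]
    _ = sw k m fun p q => sw k p fun c d => sw k h fun x y => r (x * c) • (y * (d * 𝑺 q)) := by
        congr! 3 with p q
        rw [sw_mul (by fun_prop) (by fun_prop), sw_comm]
        have e : IsLinearMap k fun z => z * 𝑺 q := by fun_prop
        simp only [map_sw_of_isLinearMap e]
        simp [mul_assoc]
    _ = sw k m fun c q => sw k q fun d q => sw k h fun x y => r (x * c) • (y * (d * 𝑺 q)) :=
        sw_assoc (by fun_prop) (by fun_prop) (by fun_prop) m
    _ = sw k h fun x y => r (x * m) • (y * 1) :=
        sw_cancel_right sw_mul_antipode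
          (fun c z => sw k h fun x y => r (x * c) • (y * z)) (by fun_prop) (by fun_prop) m
    _ = _ := by simp only [mul_one]

end Integrals

/-! ### Locating a tensor by functionals on one factor. -/

section Separation

variable {k U V W M ι : Type*} [Field k] [AddCommGroup U] [Module k U] [AddCommGroup V]
  [Module k V] [AddCommGroup W] [Module k W] [AddCommGroup M] [Module k M]

/-- If a family of linear maps on the left factor kills a tensor, so does every linear map that
kills all `v ⊗ w` with `v` in the common kernel of the family. -/
theorem eq_zero_of_rTensor_eq_zero {t : V ⊗[k] W} {g : ι → V →ₗ[k] U}
    (hg : ∀ i, (g i).rTensor W t = 0) (F : V ⊗[k] W →ₗ[k] M)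
    (hF : ∀ v, (∀ i, g i v = 0) → ∀ w, F (v ⊗ₜ w) = 0) : F t = 0 := by
  let B := Module.Basis.ofVectorSpace k W
  -- Coefficients along a basis of W are unique, so each coefficient of t lies in the common kernel.
  obtain ⟨b, rfl⟩ := TensorProduct.eq_repr_basis_right B t
  simp only [Finsupp.sum, map_sum, LinearMap.rTensor_tmul] at hg ⊢
  refine Finset.sum_eq_zero fun j hj => hF _ (fun i => ?_) _
  have e := TensorProduct.sum_tmul_basis_right_eq_zero B (b.mapRange (g i) (map_zero _))
    (by rw [Finsupp.sum_mapRange_index (by simp)]; exact hg i)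
  simpa using DFunLike.congr_fun e j

/-- A jointly injective family of linear maps on the left factor separates tensors. -/
theorem eq_of_rTensor_eq {t t' : V ⊗[k] W} (g : ι → V →ₗ[k] U)
    (hg : ∀ v, (∀ i, g i v = 0) → v = 0) (h : ∀ i, (g i).rTensor W t = (g i).rTensor W t') :
    t = t' := by
  have e : ∀ i, (g i).rTensor W (t - t') = 0 := fun i => by rw [map_sub, h, sub_self]
  exact sub_eq_zero.1 (eq_zero_of_rTensor_eq_zero e LinearMap.id (fun v hv w => by simp [hg v hv]))

variable {H : Type*} [AddCommGroup H] [Module k H] [Coalgebra k H]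

theorem sw_eq_zero_of_left {g : ι → H → k} (hg : ∀ i, IsLinearMap k (g i)) {f : H → H → M}
    (h1 : ∀ y, IsLinearMap k fun x => f x y) (h2 : ∀ x, IsLinearMap k fun y => f x y) {h : H}
    (h0 : ∀ i, (sw k h fun x y => g i x • y) = 0)
    (hf : ∀ x, (∀ i, g i x = 0) → ∀ y, f x y = 0) : sw k h f = 0 := by
  rw [sw_eq_bilin h1 h2]
  refine eq_zero_of_rTensor_eq_zero (g := fun i => (hg i).mk') (fun i => ?_) _
    (fun x hx y => by simpa using hf x hx y)
  apply (TensorProduct.lid k H).injective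
  rw [map_zero]
  simp only [← h0 i, map_comul, ← LinearEquiv.coe_coe, map_sw]
  simp

theorem sw_eq_zero_of_right {g : ι → H → k} (hg : ∀ i, IsLinearMap k (g i)) {f : H → H → M}
    (h1 : ∀ y, IsLinearMap k fun x => f x y) (h2 : ∀ x, IsLinearMap k fun y => f x y) {h : H}
    (h0 : ∀ i, (sw k h fun x y => g i y • x) = 0)
    (hf : ∀ y, (∀ i, g i y = 0) → ∀ x, f x y = 0) : sw k h f = 0 := by
  have e : sw k h f = bilin (fun y x => f x y) h2 h1
      ((TensorProduct.comm k H H) (Coalgebra.comul (R := k) h)) := by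
    rw [← LinearEquiv.coe_coe, map_comul, map_sw]
    simp
  rw [e]
  refine eq_zero_of_rTensor_eq_zero (g := fun i => (hg i).mk') (fun i => ?_) _
    (fun x hx y => by simpa using hf x hx y)
  apply (TensorProduct.lid k H).injective
  rw [map_zero]
  simp only [← h0 i, ← LinearEquiv.coe_coe, map_comul, map_sw]
  simp

end Separation

/-! ### Injectivity of the antipode and a nonzero right integral. -/

section Integrals

variable {k H : Type*} [Field k] [Ring H] [HopfAlgebra k H]

open HopfAlgebra Coalgebra

local notation "𝑺" => antipode k (A := H)

variable {l r : Module.Dual k H}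

theorem exists_apply_eq_one (hl : l ≠ 0) : ∃ m, l m = 1 := by
  obtain ⟨m, hm⟩ := DFunLike.ne_iff.1 hl
  exact ⟨(l m)⁻¹ • m, by simpa using inv_mul_cancel₀ hm⟩

theorem eq_zero_of_leftIntegral_mul_antipode (hl : l ∈ leftIntegral k H) (hl0 : l ≠ 0) {m : H}
    (hm : ∀ h, l (h * 𝑺 m) = 0) : m = 0 := by
  obtain ⟨h, hh⟩ := exists_apply_eq_one hl0
  -- The translation formula puts Δ(m) in N ⊗ H with N the space of all p such that l(· S(p)) = 0.
  -- Hence l(h S²(m₂) S(m₁)) m₃ = 0, while this sum collapses to l(h) m = m.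
  have h0 : (sw k m fun p q => sw k q fun q c => l (h * (𝑺 (𝑺 q) * 𝑺 p)) • c) = 0 := by
    refine sw_eq_zero_of_left (g := fun h p => l (h * 𝑺 p)) (by fun_prop) (by fun_prop)
      (by fun_prop) (fun h => ?_) (fun p hp y => ?_)
    · rw [← leftIntegral_mul_antipode hl]
      simp [hm, sw]
    · simp [← mul_assoc, hp, sw]
  rw [sw_cancel_left sw_antipode_antipode_mul (by fun_prop) (by fun_prop)
    (fun z c => l (h * z) • c) (by fun_prop) (by fun_prop) m, mul_one, hh, one_smul] at h0
  exact h0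

theorem antipode_injective (hl : l ∈ leftIntegral k H) (hl0 : l ≠ 0) :
    Function.Injective 𝑺 := by
  refine (injective_iff_map_eq_zero _).2 fun m hm => ?_
  exact eq_zero_of_leftIntegral_mul_antipode hl hl0 fun h => by simp [hm]

/-- The functional `h ↦ l(m₂ h S³(m₁))`. -/
def conjIntegral (l : Module.Dual k H) (m : H) : Module.Dual k H :=
  IsLinearMap.mk' (R := k) (fun h => sw k m fun p q => l (q * (h * 𝑺 (𝑺 (𝑺 p))))) (by fun_prop)

theorem conjIntegral_mem (hl : l ∈ leftIntegral k H) (m : H) :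
    conjIntegral l m ∈ leftIntegral k H := by
  rw [mem_leftIntegral_iff]
  intro h
  simp only [conjIntegral, IsLinearMap.mk'_apply]
  -- `E` is computed twice: by expanding Δ(h S³(p)) and by the translation formula. Inserting S³(m₂)
  -- S²(m₃) = ε turns one side of the integral property into a sum of `E`, and the second form
  -- collapses to the other side.
  let E : H → H → H → H := fun p c q =>
    (sw k (h * 𝑺 (𝑺 (𝑺 p))) fun x y => l (q * y) • x) * 𝑺 (𝑺 c)
  have e1 : ∀ p c q, E p c q = sw k p fun a b => sw k h fun x y =>
      l (q * (y * 𝑺 (𝑺 (𝑺 a)))) • (x * (𝑺 (𝑺 (𝑺 b)) * 𝑺 (𝑺 c))) := fun p c q => by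
    have e : IsLinearMap k fun z => z * 𝑺 (𝑺 c) := by fun_prop
    simp (disch := fun_prop) only [E, sw_mul, sw_antipode]
    rw [sw_comm]
    simp only [map_sw_of_isLinearMap e, smul_mul_assoc, mul_assoc]
  have e2 : ∀ p c q, E p c q = sw k q fun d q =>
      l (q * (h * 𝑺 (𝑺 (𝑺 p)))) • (𝑺 d * 𝑺 (𝑺 c)) := fun p c q => by
    have e : IsLinearMap k fun z => z * 𝑺 (𝑺 c) := by fun_prop
    simp only [E, leftIntegral_mul hl, map_sw_of_isLinearMap e, smul_mul_assoc]
  have c3 : ∀ h : H, (sw k h fun x y => 𝑺 (𝑺 (𝑺 x)) * 𝑺 (𝑺 y)) = counit (R := k) h • (1 : H) := by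
    intro h
    simp only [← antipode_mul_antidistrib]
    simp only [← map_sw, sw_antipode_mul, map_smul, antipode_one]
  calc (sw k h fun x y => (sw k m fun p q => l (q * (y * 𝑺 (𝑺 (𝑺 p))))) • x)
      = sw k m fun a q => sw k h fun x y => l (q * (y * 𝑺 (𝑺 (𝑺 a)))) • (x * 1) := by
        rw [sw_comm]
        congr! with x y
        have e : IsLinearMap k fun z : k => z • x := by fun_prop
        simp only [map_sw_of_isLinearMap e, mul_one]
    _ = sw k m fun a r => sw k r fun b r => sw k r fun c q => sw k h fun x y =>
          l (q * (y * 𝑺 (𝑺 (𝑺 a)))) • (x * (𝑺 (𝑺 (𝑺 b)) * 𝑺 (𝑺 c))) := by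
        refine sw_congr (fun a r => ?_) _
        exact (sw_cancel_left c3 (by fun_prop) (by fun_prop) (fun z q => sw k h fun x y =>
          l (q * (y * 𝑺 (𝑺 (𝑺 a)))) • (x * z)) (by fun_prop) (by fun_prop) r).symm
    _ = sw k m fun p r => sw k p fun a b => sw k r fun c q => sw k h fun x y =>
          l (q * (y * 𝑺 (𝑺 (𝑺 a)))) • (x * (𝑺 (𝑺 (𝑺 b)) * 𝑺 (𝑺 c))) :=
        (sw_assoc (by fun_prop) (by fun_prop) (by fun_prop) m).symm
    _ = sw k m fun p r => sw k r fun c q => E p c q := by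
        simp only [e1]
        congr! 3 with p r
        rw [sw_comm]
    _ = sw k m fun p r => l (r * (h * 𝑺 (𝑺 (𝑺 p)))) • (1 : H) := by
        simp only [e2]
        refine sw_congr (fun p r => ?_) _
        exact sw_cancel_left sw_antipode_mul_antipode (by fun_prop) (by fun_prop)
          (fun z q => l (q * (h * 𝑺 (𝑺 (𝑺 p)))) • z) (by fun_prop) (by fun_prop) r
    _ = _ := by
        have e : IsLinearMap k fun z : k => z • (1 : H) := by fun_prop
        rw [map_sw_of_isLinearMap e]

/-- Recovers l from values of left integrals on the image of S, so these integrals cannot all vanish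
there. -/
theorem sw_conjIntegral (l : Module.Dual k H) (m : H) :
    (sw k m fun p q => conjIntegral l q (𝑺 (𝑺 p))) = l m := by
  have c3 : ∀ h : H, (sw k h fun x y => 𝑺 (𝑺 x) * 𝑺 (𝑺 (𝑺 y))) = counit (R := k) h • (1 : H) := by
    intro h
    simp only [← antipode_mul_antidistrib]
    simp only [← map_sw, sw_mul_antipode, map_smul, antipode_one]
  simp only [conjIntegral, IsLinearMap.mk'_apply]
  rw [sw_cancel_left c3 (by fun_prop) (by fun_prop) (fun z q => l (q * z)) (by fun_prop)
    (by fun_prop) m, mul_one]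

theorem isRightIntegral_comp_antipode (hS : Function.Injective 𝑺) (hl : l ∈ leftIntegral k H) :
    IsRightIntegral (l ∘ₗ 𝑺) := by
  intro h
  apply hS
  have := mem_leftIntegral_iff.1 hl (𝑺 h)
  rw [sw_antipode (by fun_prop) (by fun_prop)] at this
  simpa [map_sw] using this

/-- If l' ∘ S vanished for every left integral l', the conjugated integrals would vanish on the
image of S, forcing l = 0. -/
theorem exists_isRightIntegral (hl : l ∈ leftIntegral k H) (hl0 : l ≠ 0) :
    ∃ r : Module.Dual k H, IsRightIntegral r ∧ r ≠ 0 := by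
  by_contra! hr
  refine hl0 (LinearMap.ext fun m => ?_)
  rw [← sw_conjIntegral l m]
  have : ∀ p q, conjIntegral l q (𝑺 (𝑺 p)) = 0 := fun p q => congrArg (fun f => f (𝑺 p))
    (hr _ (isRightIntegral_comp_antipode (antipode_injective hl hl0) (conjIntegral_mem hl q)))
  simp [this, sw]

end Integrals

/-! ### Nondegeneracy, bijectivity of the antipode, uniqueness of integrals. -/

section Nondegenerate

variable {k H : Type*} [Field k] [Ring H] [HopfAlgebra k H]

open HopfAlgebra Coalgebra

local notation "𝑺" => antipode k (A := H)

variable {l r : Module.Dual k H}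

/-- Both sides equal r(h₁ n) l(m h₂), by the translation formulas for l and for r. -/
theorem right_left_integral_exchange (hl : l ∈ leftIntegral k H) (hr : IsRightIntegral r)
    (h m n : H) :
    (sw k m fun p q => r (𝑺 p * n) * l (q * h)) = sw k n fun p q => r (h * p) * l (m * 𝑺 q) := by
  have e1 := congrArg (fun z => r (z * n)) (leftIntegral_mul hl h m)
  have e2 := congrArg (fun z => l (m * z)) (hr.mul h n)
  have i1 : IsLinearMap k fun z => r (z * n) := by fun_prop
  have i2 : IsLinearMap k fun z => l (m * z) := by fun_prop
  simp only [map_sw_of_isLinearMap i1, smul_mul_assoc, map_smul, smul_eq_mul] at e1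
  simp only [map_sw_of_isLinearMap i2, mul_smul_comm, map_smul, smul_eq_mul] at e2
  simp only [mul_comm (r (𝑺 _ * n)), ← e1, ← e2, mul_comm]

/-- Fix m with l(m) = 1 and insert S²(n₃) S(n₂) = ε inside l(m ·); the exchange formula then turns
r(h n) into a value of l with h on the right. The converse slice inserts into r instead. -/
theorem exists_left_slice (hl : l ∈ leftIntegral k H) (hr : IsRightIntegral r) (hl0 : l ≠ 0)
    (n : H) : ∃ m, ∀ h, r (h * n) = l (m * h) := by
  obtain ⟨m, hm⟩ := exists_apply_eq_one hl0
  refine ⟨sw k n fun a c => sw k (m * 𝑺 (𝑺 c)) fun p q => r (𝑺 p * a) • q, fun h => ?_⟩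
  have i1 : IsLinearMap k fun z => l (z * h) := by fun_prop
  calc r (h * n) = sw k n fun p y => sw k y fun q c => r (h * p) * l (m * (𝑺 (𝑺 c) * 𝑺 q)) := by
        rw [sw_cancel_right sw_antipode_antipode_mul (fun p z => r (h * p) * l (m * z))
          (by fun_prop) (by fun_prop) n, mul_one, hm, mul_one]
    _ = sw k n fun x c => sw k x fun p q => r (h * p) * l (m * (𝑺 (𝑺 c) * 𝑺 q)) :=
        (sw_assoc (by fun_prop) (by fun_prop) (by fun_prop) n).symm
    _ = _ := by
        simp only [map_sw_of_isLinearMap i1, smul_mul_assoc, map_smul, smul_eq_mul,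
          right_left_integral_exchange hl hr, mul_assoc]

theorem exists_right_slice (hl : l ∈ leftIntegral k H) (hr : IsRightIntegral r) (hr0 : r ≠ 0)
    (m : H) : ∃ n, ∀ h, l (m * h) = r (h * n) := by
  obtain ⟨n, hn⟩ := exists_apply_eq_one hr0
  refine ⟨sw k m fun a c => sw k (𝑺 (𝑺 a) * n) fun p q => l (c * 𝑺 q) • p, fun h => ?_⟩
  have i1 : IsLinearMap k fun z => r (h * z) := by fun_prop
  calc l (m * h) = sw k m fun a y => sw k y fun b c => r (𝑺 b * 𝑺 (𝑺 a) * n) * l (c * h) := by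
        rw [sw_cancel_left sw_antipode_mul_antipode (by fun_prop) (by fun_prop)
          (fun z c => r (z * n) * l (c * h)) (by fun_prop) (by fun_prop) m, one_mul, hn, one_mul]
    _ = _ := by
        simp only [map_sw_of_isLinearMap i1, mul_smul_comm, map_smul, smul_eq_mul,
          mul_assoc (𝑺 _), right_left_integral_exchange hl hr, mul_comm (l _)]

theorem eq_zero_of_forall_left_mul (hl : l ∈ leftIntegral k H) (hl0 : l ≠ 0) {h : H}
    (h0 : ∀ m, l (m * h) = 0) : h = 0 := by
  obtain ⟨r, hr, hr0⟩ := exists_isRightIntegral hl hl0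
  -- On the left kernel of r the counit vanishes: Δ(x) lies in H ⊗ ker, so l(m S(x₁) x₂) = ε(x) l(m)
  -- is zero. Since also Δ(h) lies in ker ⊗ H, it follows that h = ε(h₁) h₂ = 0.
  have key : ∀ x : H, (∀ n, r (x * n) = 0) → counit (R := k) x = 0 := by
    intro x hx
    obtain ⟨m, hm⟩ := exists_apply_eq_one hl0
    have hx' : ∀ m, l (m * x) = 0 := fun m => by
      obtain ⟨n, hn⟩ := exists_right_slice hl hr hr0 m
      rw [hn, hx]
    have e : (sw k x fun p q => l (m * (𝑺 p * q))) = 0 := by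
      refine sw_eq_zero_of_right (g := fun m y => l (m * y)) (by fun_prop) (by fun_prop)
        (by fun_prop) (fun m => ?_) (fun y hy x => ?_)
      · rw [leftIntegral_mul hl]
        simp [sw, hx']
      · rw [← mul_assoc, hy]
    have i : IsLinearMap k fun z => l (m * z) := by fun_prop
    rw [← map_sw_of_isLinearMap i, sw_antipode_mul] at e
    simpa [hm] using e
  have hr' : ∀ n, r (h * n) = 0 := fun n => by
    obtain ⟨m, hm⟩ := exists_left_slice hl hr hl0 n
    rw [hm, h0]
  rw [← sw_counit_left (k := k) (f := fun y : H => y) (by fun_prop) h]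
  refine sw_eq_zero_of_left (g := fun n x => r (x * n)) (by fun_prop) (by fun_prop)
    (by fun_prop) (fun n => ?_) (fun x hx y => by rw [key x hx, zero_smul])
  rw [hr.mul]
  simp [sw, hr']

/-- For a functional p killing the image of S, p(h₁) l(m h₂) = p(S(m₁)) l(m₂ h) = 0. Nondegeneracy
gives p(h₁) h₂ = 0, and the counit gives p = 0. -/
theorem antipode_surjective (hl : l ∈ leftIntegral k H) (hl0 : l ≠ 0) :
    Function.Surjective 𝑺 := by
  rw [← LinearMap.range_eq_top]
  by_contra hS
  obtain ⟨p, hp0, hp⟩ := Submodule.exists_le_ker_of_lt_top _ (lt_top_iff_ne_top.2 hS)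
  have hp' : ∀ x, p (𝑺 x) = 0 := fun x => hp ⟨x, rfl⟩
  refine hp0 (LinearMap.ext fun h => ?_)
  have e : (sw k h fun x y => p x • y) = 0 := by
    refine eq_zero_of_forall_left_mul hl hl0 fun m => ?_
    have i : IsLinearMap k fun z => l (m * z) := by fun_prop
    have := congrArg p (leftIntegral_mul hl h m)
    simp only [map_sw, map_smul, hp', smul_eq_mul, mul_zero] at this
    simp only [map_sw_of_isLinearMap i, mul_smul_comm, map_smul, smul_eq_mul, mul_comm (p _), this]
    simp [sw]
  have := congrArg (counit (R := k)) e
  simp only [map_sw, map_smul, smul_eq_mul, map_zero] at this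
  rw [← sw_counit_right (k := k) (f := fun x => p x) (by fun_prop) h]
  simpa only [smul_eq_mul, mul_comm, LinearMap.zero_apply] using this

theorem exists_antipode_inverse (hl : l ∈ leftIntegral k H) (hl0 : l ≠ 0) :
    ∃ T : H →ₗ[k] H, (∀ h, 𝑺 (T h) = h) ∧ ∀ h, T (𝑺 h) = h := by
  let e := LinearEquiv.ofBijective 𝑺 ⟨antipode_injective hl hl0, antipode_surjective hl hl0⟩
  exact ⟨e.symm, e.apply_symm_apply, e.symm_apply_apply⟩

section Inverse

variable {T : H →ₗ[k] H} (hST : ∀ h : H, antipode k (T h) = h)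
  (hTS : ∀ h : H, T (antipode k h) = h)
include hST hTS

omit hST in
theorem antipodeInv_one : T 1 = 1 := by
  simpa using hTS 1

theorem antipodeInv_mul (a b : H) : T (a * b) = T b * T a := by
  rw [← hTS (T b * T a), antipode_mul_antidistrib, hST, hST]

theorem sw_mul_antipodeInv (h : H) :
    (sw k h fun x y => y * T x) = counit (R := k) h • (1 : H) := by
  have : ∀ x y, y * T x = T (x * 𝑺 y) := fun x y => by rw [antipodeInv_mul hST hTS, hTS]
  simp only [this, ← map_sw, sw_mul_antipode, map_smul]
  rw [antipodeInv_one hTS]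

theorem sw_antipodeInv_mul (h : H) :
    (sw k h fun x y => T y * x) = counit (R := k) h • (1 : H) := by
  have : ∀ x y, T y * x = T (𝑺 x * y) := fun x y => by rw [antipodeInv_mul hST hTS, hTS]
  simp only [this, ← map_sw, sw_antipode_mul, map_smul]
  rw [antipodeInv_one hTS]

end Inverse

theorem eq_zero_of_forall_mul_right (hl : l ∈ leftIntegral k H) (hl0 : l ≠ 0) {m : H}
    (h0 : ∀ h, l (m * h) = 0) : m = 0 := by
  obtain ⟨T, hST, hTS⟩ := exists_antipode_inverse hl hl0
  obtain ⟨h, hh⟩ := exists_apply_eq_one hl0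
  -- Here Δ(m) lies in H ⊗ N, and l(m₃ S⁻¹(m₂) h) m₁ collapses to l(h) m = m.
  have e : (sw k m fun p q => sw k p fun a b => l (q * T b * h) • a) = 0 := by
    refine sw_eq_zero_of_right (g := fun h q => l (q * h)) (by fun_prop) (by fun_prop)
      (by fun_prop) (fun h => ?_) (fun y hy x => ?_)
    · apply antipode_injective hl hl0
      have := leftIntegral_mul hl h m
      simp only [h0, zero_smul] at this
      simp only [map_sw, map_smul, ← this, map_zero]
      simp [sw]
    · simp [mul_assoc, hy, sw]
  rw [sw_assoc (f := fun a b q => l (q * T b * h) • a) (by fun_prop) (by fun_prop) (by fun_prop),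
    sw_cancel_right (sw_mul_antipodeInv hST hTS) (fun a z => l (z * h) • a) (by fun_prop)
      (by fun_prop), one_mul, hh, one_smul] at e
  exact e

/-- Passing through a right integral writes l' as l(m ·). The integral property of l' makes m
coinvariant, so m = ε(m) 1 and the scalar is ε(m). -/
theorem exists_smul_eq_of_mem_leftIntegral (hl : l ∈ leftIntegral k H) (hl0 : l ≠ 0)
    {l' : Module.Dual k H} (hl' : l' ∈ leftIntegral k H) : ∃ c : k, l' = c • l := by
  obtain ⟨r, hr, hr0⟩ := exists_isRightIntegral hl hl0
  obtain ⟨n, hn⟩ := exists_right_slice hl' hr hr0 1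
  obtain ⟨m, hm⟩ := exists_left_slice hl hr hl0 n
  have hm : ∀ h, l' h = l (m * h) := fun h => by rw [← hm, ← hn, one_mul]
  have e1 : ∀ h, (sw k m fun p q => l (q * h) • p) = l (m * h) • (1 : H) := fun h => by
    apply antipode_injective hl hl0
    rw [map_sw, map_smul, antipode_one, ← hm, ← mem_leftIntegral_iff.1 hl' h]
    simp only [map_smul, hm, leftIntegral_mul hl]
  have e2 : ∀ p : Module.Dual k H, (sw k m fun x y => p x • y) = p 1 • m := fun p => by
    rw [← sub_eq_zero]
    refine eq_zero_of_forall_mul_right hl hl0 fun h => ?_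
    have i : IsLinearMap k fun z => l (z * h) := by fun_prop
    have := congrArg p (e1 h)
    simp only [map_sw, map_smul, smul_eq_mul] at this
    simp only [sub_mul, map_sub, map_sw_of_isLinearMap i, smul_mul_assoc, map_smul, smul_eq_mul,
      mul_comm (p _), this, sub_self]
  have e3 : m = counit (R := k) m • (1 : H) := by
    rw [← sub_eq_zero, ← Module.forall_dual_apply_eq_zero_iff k]
    intro p
    have := congrArg (counit (R := k)) (e2 p)
    simp only [map_sw, map_smul, smul_eq_mul, mul_comm (p _)] at this
    have h3 := sw_counit_right (k := k) (f := fun x => p x) (by fun_prop) m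
    simp only [smul_eq_mul] at h3
    rw [map_sub, map_smul, ← h3, this, smul_eq_mul, sub_self]
  refine ⟨counit (R := k) m, LinearMap.ext fun h => ?_⟩
  rw [hm, e3]
  simp

end Nondegenerate

/-! ### A nonzero integral from a rational functional. -/

section Existence

variable {k H : Type*} [Field k] [Ring H] [HopfAlgebra k H]

open HopfAlgebra Coalgebra

local notation "𝑺" => antipode k (A := H)

theorem exists_coaction {f : Module.Dual k H} (hf : f ∈ rationalDual k H) :
    ∃ s : Finset (Module.Dual k H × H), ∀ h,
      (sw k h fun x y => f y • x) = ∑ i ∈ s, i.1 h • i.2 := by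
  obtain ⟨t, ht⟩ := hf
  obtain ⟨s, rfl⟩ := TensorProduct.exists_finset t
  refine ⟨s, fun h => ?_⟩
  rw [← sub_eq_zero, ← Module.forall_dual_apply_eq_zero_iff k]
  intro p
  have := congrArg (fun f : Module.Dual k H => f h) (ht p)
  rw [map_sub, sub_eq_zero, map_sw]
  refine Eq.trans ?_ (this.trans ?_)
  · change _ = (toConv p * toConv f) h
    simp [convMul_apply_eq_sw, mul_comm, -LinearMap.convMul_apply]
  · simp [mul_comm]

section Projection

variable {f : Module.Dual k H} {s : Finset (Module.Dual k H × H)}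
  (hs : ∀ h, (sw k h fun x y => f y • x) = ∑ i ∈ s, i.1 h • i.2)
include hs

theorem coaction_coassoc {M : Type*} [AddCommGroup M] [Module k M] {G : H → H → M}
    (h1 : ∀ y, IsLinearMap k fun x => G x y) (h2 : ∀ x, IsLinearMap k fun y => G x y) (h : H) :
    ∑ i ∈ s, i.1 h • sw k i.2 G = sw k h fun x y => ∑ i ∈ s, i.1 y • G x i.2 := by
  have i1 : IsLinearMap k fun x => sw k x G := by fun_prop
  have e1 := congrArg (IsLinearMap.mk' _ i1) (hs h)
  have e2 : ∀ x y, (sw k y fun b c => f c • G x b) = ∑ i ∈ s, i.1 y • G x i.2 := fun x y => by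
    have := congrArg (IsLinearMap.mk' _ (h2 x)) (hs y)
    simpa only [map_sum, map_smul, map_sw, IsLinearMap.mk'_apply] using this
  simp only [map_sum, map_smul, map_sw, IsLinearMap.mk'_apply] at e1
  rw [← e1]
  simp only [← e2]
  rw [← sw_assoc (f := fun x b c => f c • G x b) (by fun_prop) (by fun_prop) (by fun_prop)]
  refine sw_congr (fun x y => ?_) h
  have i3 : IsLinearMap k fun z : M => f y • z := by fun_prop
  rw [map_sw_of_isLinearMap i3]

/-- Coassociativity as an identity of tensors with maps in the first factor: the maps can then be
evaluated at points that depend on the second factor. -/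
theorem coaction_coassoc_tmul :
    ∑ i ∈ s, (sw k i.2 fun a r => (i.1.smulRight a) ⊗ₜ[k] r) =
      ∑ i ∈ s, (IsLinearMap.mk' (R := k) (fun z => sw k z fun c d => i.1 d • c) (by fun_prop))
        ⊗ₜ[k] i.2 := by
  refine eq_of_rTensor_eq (fun z : H => LinearMap.applyₗ (R := k) z)
    (fun v hv => LinearMap.ext hv) (fun z => ?_)
  have := coaction_coassoc hs (G := fun x y => x ⊗ₜ[k] y) (by fun_prop) (by fun_prop) z
  rw [sw_sum] at this
  simp only [map_sum, map_sw, LinearMap.rTensor_tmul, LinearMap.applyₗ_apply_apply,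
    IsLinearMap.mk'_apply, LinearMap.smulRight_apply]
  convert this using 2 with i hi i hi
  · have e : IsLinearMap k fun t : H ⊗[k] H => i.1 z • t := by fun_prop
    simp only [map_sw_of_isLinearMap e]
    rfl
  · have e : IsLinearMap k fun t : H => t ⊗ₜ[k] i.2 := by fun_prop
    simp only [map_sw_of_isLinearMap e]
    rfl

/-- The integral obtained by projecting a rational functional with coaction
`∑ fᵢ ⊗ xᵢ` onto the coinvariants, after multiplying it by `p`. -/
def coinvariantProj (s : Finset (Module.Dual k H × H)) (p : Module.Dual k H) : Module.Dual k H :=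
  IsLinearMap.mk' (R := k)
    (fun h => ∑ i ∈ s, sw k i.2 fun a b => p b * i.1 (h * 𝑺 (𝑺 a))) (by fun_prop)

/-- Evaluate the tensor identity at h S²(a), with a from the coaction. On one side S²(a) S(u)
cancels, on the other c S(u) does. -/
theorem coinvariantProj_mem (p : Module.Dual k H) : coinvariantProj s p ∈ leftIntegral k H := by
  rw [mem_leftIntegral_iff]
  intro h
  let F : (H →ₗ[k] H) ⊗[k] H →ₗ[k] H := bilin (fun A r => sw k r fun a b =>
    p b • sw k (h * 𝑺 (𝑺 a)) fun c d => c * 𝑺 (LinearMap.applyₗ d A)) (by fun_prop)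
    (fun A => by simp only [LinearMap.applyₗ_apply_apply]; fun_prop)
  have e := congrArg F (coaction_coassoc_tmul hs)
  simp only [F, map_sum, map_sw, bilin_tmul, LinearMap.applyₗ_apply_apply,
    IsLinearMap.mk'_apply, LinearMap.smulRight_apply, map_smul, mul_smul_comm] at e
  have i1 : ∀ x : H, IsLinearMap k fun c : k => c • x := fun x => by fun_prop
  have i2 : ∀ x : H, IsLinearMap k fun y : H => x * y := fun x => by fun_prop
  have i3 : ∀ x : k, IsLinearMap k fun y : H => x • y := fun x => by fun_prop
  have e1 : ∀ x : Module.Dual k H × H, (sw k x.2 fun u y => sw k y fun a b => p b •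
      sw k (h * 𝑺 (𝑺 a)) fun c d => x.1 d • (c * 𝑺 u)) =
      sw k h fun c d => (sw k x.2 fun a b => p b * x.1 (d * 𝑺 (𝑺 a))) • c := fun x => by
    simp (disch := fun_prop) only [sw_mul, sw_antipode]
    simp only [mul_assoc, map_sw_of_isLinearMap (i1 _), map_sw_of_isLinearMap (i3 _)]
    rw [sw_comm]
    calc _ = sw k x.2 fun u y => sw k y fun r b => sw k r fun a a' => sw k h fun c d =>
          p b • x.1 (d * 𝑺 (𝑺 a')) • (c * (𝑺 (𝑺 a) * 𝑺 u)) := by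
          refine sw_congr (fun u y => sw_congr (fun r b => ?_) _) _
          rw [sw_comm]
      _ = sw k x.2 fun u y => sw k y fun a y => sw k y fun a' b => sw k h fun c d =>
          p b • x.1 (d * 𝑺 (𝑺 a')) • (c * (𝑺 (𝑺 a) * 𝑺 u)) := by
          refine sw_congr (fun u y => ?_) _
          exact sw_assoc (by fun_prop) (by fun_prop) (by fun_prop) _
      _ = sw k x.2 fun a' b => sw k h fun c d =>
          p b • x.1 (d * 𝑺 (𝑺 a')) • (c * 1) :=
          sw_cancel_left sw_antipode_antipode_mul (by fun_prop) (by fun_prop)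
            (fun z y => sw k y fun a' b => sw k h fun c d =>
              p b • x.1 (d * 𝑺 (𝑺 a')) • (c * z)) (by fun_prop) (by fun_prop) _
      _ = _ := by simp only [mul_one, smul_smul]
  have e2 : ∀ z : H, ∀ g : Module.Dual k H, (sw k z fun c d => c * sw k d fun u y => g y • 𝑺 u) =
      g z • 1 := fun z g => by
    simp only [map_sw_of_isLinearMap (i2 _), mul_smul_comm]
    exact sw_cancel_left sw_mul_antipode (by fun_prop) (by fun_prop)
      (fun z y => g y • z) (by fun_prop) (by fun_prop) _
  simp only [e1, e2] at e
  simp only [coinvariantProj, IsLinearMap.mk'_apply, Finset.sum_smul, sw_sum,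
    map_sw_of_isLinearMap (i1 _)]
  simpa only [map_sw_of_isLinearMap (i1 _), smul_smul] using e

end Projection

/-- As for Hopf modules, a functional is rebuilt from its coinvariant projections: f(h) = ∑ fᵢ(h
S(xᵢ₂) S²(xᵢ₁)). If every projection vanished, so would f. -/
theorem exists_leftIntegral_ne_zero (hH : IsCoFrobenius k H) :
    ∃ l ∈ leftIntegral k H, l ≠ 0 := by
  obtain ⟨f, hf, hf0⟩ := Submodule.exists_mem_ne_zero_of_ne_bot hH
  obtain ⟨s, hs⟩ := exists_coaction hf
  by_contra! h0
  have h0 : ∀ p, coinvariantProj s p = 0 := fun p => h0 _ (coinvariantProj_mem hs p)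
  refine hf0 (LinearMap.ext fun h => ?_)
  have e1 : f h = ∑ i ∈ s, sw k i.2 fun a b => i.1 (h * (𝑺 b * 𝑺 (𝑺 a))) := by
    have c1 : ∀ i : Module.Dual k H × H, (sw k i.2 fun a b => i.1 (h * (𝑺 b * 𝑺 (𝑺 a)))) =
        i.1 h * counit (R := k) i.2 := fun i => by
      have i1 : IsLinearMap k fun z => i.1 (h * z) := by fun_prop
      rw [← map_sw_of_isLinearMap i1, sw_antipode_mul_antipode, mul_smul_comm, map_smul, mul_one,
        smul_eq_mul, mul_comm]
    have := congrArg (counit (R := k)) (hs h)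
    simp only [map_sw, map_sum, map_smul, smul_eq_mul] at this
    simp only [c1, ← this]
    have c2 := sw_counit_left (k := k) (f := fun x => f x) (by fun_prop) h
    simpa only [smul_eq_mul, mul_comm] using c2.symm
  let F : Module.Dual k H ⊗[k] H →ₗ[k] k :=
    bilin (fun g b => LinearMap.applyₗ (h * 𝑺 b) g) (by fun_prop)
      (fun A => by simp only [LinearMap.applyₗ_apply_apply]; fun_prop)
  let t : Module.Dual k H ⊗[k] H := ∑ i ∈ s, sw k i.2 fun a b =>
    (IsLinearMap.mk' (R := k) (fun z => i.1 (z * 𝑺 (𝑺 a))) (by fun_prop)) ⊗ₜ[k] b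
  have ht : t = 0 := by
    refine eq_of_rTensor_eq (fun z : H => LinearMap.applyₗ (R := k) z)
      (fun v hv => LinearMap.ext hv) (fun z => (TensorProduct.lid k H).injective ?_)
    rw [map_zero, map_zero, ← Module.forall_dual_apply_eq_zero_iff k]
    intro p
    have := congrArg (fun f => f z) (h0 p)
    simp only [coinvariantProj, IsLinearMap.mk'_apply, LinearMap.zero_apply] at this
    simp only [t, ← this, ← LinearEquiv.coe_coe, map_sum, map_sw, LinearMap.rTensor_tmul]
    simp [mul_comm]
  have e2 := congrArg F ht
  simp only [F, t, map_sum, map_sw, bilin_tmul, LinearMap.applyₗ_apply_apply,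
    IsLinearMap.mk'_apply, mul_assoc, map_zero] at e2
  rw [e1, e2]
  rfl

end Existence

/-! ### The modular grouplike and the Frobenius automorphism. -/

section Modular

variable {k H : Type*} [Field k] [Ring H] [HopfAlgebra k H]

open HopfAlgebra Coalgebra

local notation "𝑺" => antipode k (A := H)

variable {l : Module.Dual k H}

theorem isModularElement_iff {a : GroupLike k H} : IsModularElement a ↔
    ∀ l ∈ leftIntegral k H, ∀ h : H,
      (sw k h fun x y => l x • y) = l h • ((a⁻¹ : GroupLike k H) : H) := by
  have : ∀ (l : Module.Dual k H) (h : H), TensorProduct.lid k H (LinearMap.rTensor H l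
      (comul (R := k) h)) = sw k h fun x y => l x • y := fun l h => by
    simp only [← LinearEquiv.coe_coe, map_comul, map_sw]
    simp
  simp only [IsModularElement, this]

theorem leftIntegral_conv_mem (hl : l ∈ leftIntegral k H) (p : Module.Dual k H) :
    IsLinearMap.mk' (R := k) (fun h => sw k h fun x y => l x * p y) (by fun_prop) ∈
      leftIntegral k H := by
  rw [mem_leftIntegral_iff]
  intro h
  have i1 : ∀ x : H, IsLinearMap k fun c : k => c • x := fun x => by fun_prop
  simp only [IsLinearMap.mk'_apply, map_sw_of_isLinearMap (i1 _)]
  rw [← sw_assoc (f := fun x y z => (l y * p z) • x) (by fun_prop) (by fun_prop) (by fun_prop)]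
  refine sw_congr (fun x y => ?_) h
  have i3 : IsLinearMap k fun z : H => p y • z := by fun_prop
  have := congrArg (IsLinearMap.mk' _ i3) (mem_leftIntegral_iff.1 hl x)
  simpa only [map_sw, IsLinearMap.mk'_apply, smul_smul, mul_comm (p y)] using this

/-- Each l * p is a left integral, hence a multiple of l; so l(h₁) h₂ = l(h) b, and coassociativity
makes b grouplike. -/
theorem exists_groupLike (hl : l ∈ leftIntegral k H) (hl0 : l ≠ 0) :
    ∃ b : GroupLike k H, ∀ h : H, (sw k h fun x y => l x • y) = l h • (b : H) := by
  obtain ⟨h0, hh0⟩ := exists_apply_eq_one hl0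
  let b : H := sw k h0 fun x y => l x • y
  have hb : ∀ h : H, (sw k h fun x y => l x • y) = l h • b := fun h => by
    rw [← sub_eq_zero, ← Module.forall_dual_apply_eq_zero_iff k]
    intro p
    obtain ⟨c, hc⟩ := exists_smul_eq_of_mem_leftIntegral hl hl0 (leftIntegral_conv_mem hl p)
    have hc := fun h => congrArg (fun f => f h) hc
    simp only [IsLinearMap.mk'_apply, LinearMap.smul_apply, smul_eq_mul] at hc
    simp only [b, map_sub, map_sw, map_smul, smul_eq_mul, hc, hh0]
    ring
  refine ⟨⟨b, ⟨?_, ?_⟩⟩, hb⟩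
  · have := sw_counit_right (k := k) (f := fun x => l x) (by fun_prop) h0
    simp only [smul_eq_mul, mul_comm (counit (R := k) _), hh0] at this
    simpa only [b, map_sw, map_smul, smul_eq_mul] using this
  · have i1 : ∀ x : k, IsLinearMap k fun t : H ⊗[k] H => x • t := fun x => by fun_prop
    have i2 : ∀ x : H, IsLinearMap k fun t : H => x ⊗ₜ[k] t := fun x => by fun_prop
    have i3 : ∀ x : H, IsLinearMap k fun t : H => t ⊗ₜ[k] x := fun x => by fun_prop
    calc comul b = sw k h0 fun x y => sw k y fun c d => l x • (c ⊗ₜ[k] d) := by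
          simp only [b, map_sw, map_smul, ← map_sw_of_isLinearMap (i1 _), sw_tmul]
      _ = sw k h0 fun e d => sw k e fun x c => l x • (c ⊗ₜ[k] d) :=
          (sw_assoc (by fun_prop) (by fun_prop) (by fun_prop) _).symm
      _ = sw k h0 fun e d => l e • (b ⊗ₜ[k] d) := by
          refine sw_congr (fun e d => ?_) _
          rw [TensorProduct.smul_tmul', ← hb, map_sw_of_isLinearMap (i3 d)]
          rfl
      _ = b ⊗ₜ[k] b := by
          simp only [← TensorProduct.tmul_smul, ← map_sw_of_isLinearMap (i2 b), b]

theorem existsUnique_isModularElement (hl : l ∈ leftIntegral k H) (hl0 : l ≠ 0) :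
    ∃! a : GroupLike k H, IsModularElement a := by
  obtain ⟨b, hb⟩ := exists_groupLike hl hl0
  refine ⟨b⁻¹, isModularElement_iff.2 fun l' hl' h => ?_, fun a ha => ?_⟩
  · obtain ⟨c, rfl⟩ := exists_smul_eq_of_mem_leftIntegral hl hl0 hl'
    have i1 : IsLinearMap k fun t : H => c • t := by fun_prop
    simp only [LinearMap.smul_apply, smul_assoc, ← map_sw_of_isLinearMap i1, hb, inv_inv]
  · obtain ⟨h, hh⟩ := exists_apply_eq_one hl0
    have := isModularElement_iff.1 ha l hl h
    rw [hb, hh, one_smul, one_smul] at this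
    rw [GroupLike.val_injective this, inv_inv]

theorem isRightIntegral_mul_groupLike {b : GroupLike k H}
    (hb : ∀ h : H, (sw k h fun x y => l x • y) = l h • (b : H)) :
    IsRightIntegral (l ∘ₗ LinearMap.mulRight k (b : H)) := by
  intro h
  have hbb : (b : H) * ((b⁻¹ : GroupLike k H) : H) = 1 := by
    rw [← GroupLike.val_mul, mul_inv_cancel, GroupLike.val_one]
  have e := congrArg (fun z => z * ((b⁻¹ : GroupLike k H) : H)) (hb (h * b))
  have i1 : IsLinearMap k fun z => z * ((b⁻¹ : GroupLike k H) : H) := by fun_prop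
  simp (disch := fun_prop) only [sw_mul] at e
  simp (disch := first | exact b.isGroupLikeElem_val | fun_prop) only [sw_groupLike] at e
  simpa only [map_sw_of_isLinearMap i1, smul_mul_assoc, mul_assoc, hbb, mul_one,
    LinearMap.comp_apply, LinearMap.mulRight_apply] using e

/-- Since l(· b) is a nonzero right integral, the slice lemmas between l and l(· b) give both
directions. -/
theorem exists_frobenius_apply (hl : l ∈ leftIntegral k H) (hl0 : l ≠ 0) :
    (∀ h, ∃ h', ∀ m, l (m * h) = l (h' * m)) ∧ ∀ h', ∃ h, ∀ m, l (m * h) = l (h' * m) := by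
  obtain ⟨b, hb⟩ := exists_groupLike hl hl0
  have hr := isRightIntegral_mul_groupLike hb
  have hbb : ((b⁻¹ : GroupLike k H) : H) * (b : H) = 1 := by
    rw [← GroupLike.val_mul, inv_mul_cancel, GroupLike.val_one]
  have hr0 : l ∘ₗ LinearMap.mulRight k (b : H) ≠ 0 := fun h0 => hl0 <| LinearMap.ext fun h => by
    have := congrArg (fun f => f (h * ((b⁻¹ : GroupLike k H) : H))) h0
    simpa [-GroupLike.val_inv, mul_assoc, hbb] using this
  refine ⟨fun h => ?_, fun h' => ?_⟩
  · obtain ⟨h', hh⟩ := exists_left_slice hl hr hl0 (h * ((b⁻¹ : GroupLike k H) : H))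
    refine ⟨h', fun m => ?_⟩
    rw [← hh]
    simp [-GroupLike.val_inv, mul_assoc, hbb]
  · obtain ⟨n, hn⟩ := exists_right_slice hl hr hr0 h'
    exact ⟨n * b, fun m => by rw [hn]; simp [mul_assoc]⟩

theorem existsUnique_isFrobeniusAut (hl : l ∈ leftIntegral k H) (hl0 : l ≠ 0) :
    ∃! χ : H ≃ₐ[k] H, IsFrobeniusAut χ := by
  obtain ⟨h1, h2⟩ := exists_frobenius_apply hl hl0
  choose χ hχ using h1
  have ext : ∀ x y, (∀ m, l (x * m) = l (y * m)) → x = y := fun x y h => by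
    rw [← sub_eq_zero]
    exact eq_zero_of_forall_mul_right hl hl0 fun m => by rw [sub_mul, map_sub, h, sub_self]
  have ext' : ∀ x y, (∀ m, l (m * x) = l (m * y)) → x = y := fun x y h => by
    rw [← sub_eq_zero]
    exact eq_zero_of_forall_left_mul hl hl0 fun m => by rw [mul_sub, map_sub, h, sub_self]
  let f : H →ₗ[k] H :=
    { toFun := χ
      map_add' := fun x y => ext _ _ fun m => by
        rw [← hχ, mul_add, add_mul, map_add, map_add, ← hχ, ← hχ]
      map_smul' := fun c x => ext _ _ fun m => by
        rw [← hχ, mul_smul_comm, RingHom.id_apply, smul_mul_assoc, map_smul, map_smul, hχ] }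
  let g : H →ₐ[k] H := AlgHom.ofLinearMap f
    (ext _ _ fun m => by simp only [f, LinearMap.coe_mk, AddHom.coe_mk, ← hχ, mul_one, one_mul])
    (fun x y => ext _ _ fun m => by
      simp only [f, LinearMap.coe_mk, AddHom.coe_mk]
      rw [← hχ, ← mul_assoc, hχ, ← mul_assoc, hχ, mul_assoc])
  have hg : Function.Bijective g := by
    refine ⟨fun x y hxy => ext' _ _ fun m => ?_, fun y => ?_⟩
    · have : χ x = χ y := hxy
      rw [hχ x, hχ y, this]
    · obtain ⟨x, hx⟩ := h2 y
      exact ⟨x, ext _ _ fun m => by rw [← hx]; exact (hχ x m).symm⟩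
  refine ⟨AlgEquiv.ofBijective g hg, fun l' hl' h m => ?_, fun χ' h' => ?_⟩
  · obtain ⟨c, rfl⟩ := exists_smul_eq_of_mem_leftIntegral hl hl0 hl'
    exact congrArg (c • ·) (hχ h m)
  · exact AlgEquiv.ext fun x => ext _ _ fun m => by
      rw [← h' l hl]
      exact hχ x m

/-- The generalized Frobenius automorphism is `S⁻²` twisted by its counit. -/
theorem IsFrobeniusAut.apply_eq (hl : l ∈ leftIntegral k H) (hl0 : l ≠ 0) {χ : H ≃ₐ[k] H}
    (hχ : IsFrobeniusAut χ) {T : H →ₗ[k] H}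
    (hTS : ∀ h : H, T (antipode k h) = h) (h : H) :
    χ h = sw k h fun x y => counitComp χ y • T (T x) := by
  have hχ := hχ l hl
  have i1 : ∀ m : H, IsLinearMap k fun z => l (z * m) := fun m => by fun_prop
  -- Pairing the second factor with l(· m) reduces this to two uses of the translation formula,
  -- linked by l(m h) = l(χ(h) m). The counit on the second factor then gives S²(χ(h)) = α(h₂) h₁.
  have key : (sw k h fun x y => x ⊗ₜ[k] χ y) = sw k (χ h) fun x y => 𝑺 (𝑺 x) ⊗ₜ[k] y := by
    have hsep : ∀ v : H, (∀ m, l (v * m) = 0) → v = 0 :=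
      fun v hv => eq_zero_of_forall_mul_right hl hl0 hv
    apply (TensorProduct.comm k H H).injective
    refine eq_of_rTensor_eq (fun m : H => IsLinearMap.mk' _ (i1 m)) hsep (fun m => ?_)
    apply (TensorProduct.lid k H).injective
    simp only [← LinearEquiv.coe_coe, map_sw]
    simp only [LinearEquiv.coe_coe, TensorProduct.comm_tmul, LinearMap.rTensor_tmul,
      TensorProduct.lid_tmul, IsLinearMap.mk'_apply]
    have e1 := congrArg 𝑺 (leftIntegral_mul hl m (χ h))
    have e2 : (sw k h fun x y => l (χ y * m) • x) = sw k m fun p q => l (χ h * q) • 𝑺 p :=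
      (sw_congr (fun x y => by rw [hχ y m]) h).symm.trans
        ((leftIntegral_mul hl h m).trans (sw_congr (fun p q => by rw [hχ h q]) m))
    simp only [map_sw, map_smul] at e1
    rw [← e1, e2]
  let F : H ⊗[k] H →ₗ[k] H := bilin (fun x y => counit (R := k) y • T (T x)) (by fun_prop)
    (by fun_prop)
  have e := congrArg F key
  simp only [F, map_sw, bilin_tmul, hTS] at e
  rw [sw_counit_right (by fun_prop)] at e
  exact e.symm

end Modular

open HopfAlgebra Coalgebra

/-! ### Convolution on tensor products of coalgebras. -/

section Conv

variable {k C D A : Type*} [CommSemiring k] [AddCommMonoid C] [Module k C] [Coalgebra k C]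
  [AddCommMonoid D] [Module k D] [Coalgebra k D] [Semiring A] [Algebra k A]

theorem comul_tmul_eq_sw (c : C) (d : D) :
    comul (R := k) (c ⊗ₜ[k] d) =
      sw k c fun x y => sw k d fun p q => (x ⊗ₜ[k] p) ⊗ₜ[k] (y ⊗ₜ[k] q) := by
  rw [TensorProduct.comul_tmul, ← sw_tmul c, ← sw_tmul d]
  simp only [sw, TensorProduct.sum_tmul, TensorProduct.tmul_sum, map_sum,
    TensorProduct.AlgebraTensorModule.tensorTensorTensorComm_tmul]
  exact Finset.sum_comm

theorem convMul_tmul_eq_sw (f g : WithConv (C ⊗[k] D →ₗ[k] A)) (c : C) (d : D) :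
    (f * g) (c ⊗ₜ d) =
      sw k c fun x y => sw k d fun p q => f (x ⊗ₜ p) * g (y ⊗ₜ q) := by
  rw [LinearMap.convMul_apply, comul_tmul_eq_sw, map_sw, map_sw]
  simp only [map_sw]
  simp

theorem rid_map_comul (Q : C →ₗ[k] A) (f : C →ₗ[k] k) (c : C) :
    TensorProduct.rid k A (TensorProduct.map Q f (comul c)) =
      (toConv Q * toConv (Algebra.linearMap k A ∘ₗ f)) c := by
  rw [convMul_apply_eq_sw]
  simp only [← LinearEquiv.coe_coe, map_comul, map_sw]
  simp [Algebra.algebraMap_eq_smul_one]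

theorem lid_map_comul (Q : C →ₗ[k] A) (f : C →ₗ[k] k) (c : C) :
    TensorProduct.lid k A (TensorProduct.map f Q (comul c)) =
      (toConv (Algebra.linearMap k A ∘ₗ f) * toConv Q) c := by
  rw [convMul_apply_eq_sw]
  simp only [← LinearEquiv.coe_coe, map_comul, map_sw]
  simp [Algebra.algebraMap_eq_smul_one]

end Conv

/-! ### The functionals u and v, and the reversed structure. -/

namespace Coquasitriangular

variable {k H : Type*} [Field k] [Ring H] [HopfAlgebra k H] (σ : Coquasitriangular k H)

local notation "𝑺" => antipode k (A := H)

theorem form_mul_tmul (h l m : H) : σ.form ((h * l) ⊗ₜ m) =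
    sw k m fun x y => σ.form (h ⊗ₜ x) * σ.form (l ⊗ₜ y) := by
  have := congrArg (fun f => f m) (σ.form_mul_left h l)
  rw [convMul_apply_eq_sw] at this
  exact this

theorem form_tmul_mul (h l m : H) : σ.form (h ⊗ₜ (l * m)) =
    sw k h fun x y => σ.form (x ⊗ₜ m) * σ.form (y ⊗ₜ l) := by
  have := congrArg (fun f => f h) (σ.form_mul_right l m)
  rw [convMul_apply_eq_sw] at this
  exact this

theorem mul_conv_form :
    toConv (LinearMap.mul' k H ∘ₗ (TensorProduct.comm k H H).toLinearMap) *
        toConv (Algebra.linearMap k H ∘ₗ σ.form) =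
      toConv (Algebra.linearMap k H ∘ₗ σ.form) * toConv (LinearMap.mul' k H) := by
  ext h l
  simp only [TensorProduct.AlgebraTensorModule.curry_apply, LinearMap.restrictScalars_self,
    TensorProduct.curry_apply]
  exact (rid_map_comul _ _ _).symm.trans ((σ.mul_comm_form h l).trans (lid_map_comul _ _ _))

theorem mul_comm_form_eq_sw (h l : H) :
    (sw k h fun x y => sw k l fun p q => σ.form (y ⊗ₜ q) • (p * x)) =
      sw k h fun x y => sw k l fun p q => σ.form (x ⊗ₜ p) • (y * q) := by
  have := congrArg (fun f => f (h ⊗ₜ l)) σ.mul_conv_form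
  simp only [convMul_tmul_eq_sw] at this
  simpa [Algebra.algebraMap_eq_smul_one] using this

theorem antipode_form_conv (h m : H) :
    (sw k h fun x y => sw k m fun p q => σ.form (𝑺 x ⊗ₜ p) * σ.form (y ⊗ₜ q)) =
      counit (R := k) h * counit (R := k) m := by
  have i : IsLinearMap k fun z => σ.form (z ⊗ₜ m) := by fun_prop
  simp only [← form_mul_tmul, ← map_sw_of_isLinearMap i, sw_antipode_mul]
  rw [← TensorProduct.smul_tmul', map_smul, σ.form_one_left, smul_eq_mul]

theorem form_conv_antipode (h m : H) :
    (sw k h fun x y => sw k m fun p q => σ.form (x ⊗ₜ p) * σ.form (𝑺 y ⊗ₜ q)) =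
      counit (R := k) h * counit (R := k) m := by
  have i : IsLinearMap k fun z => σ.form (z ⊗ₜ m) := by fun_prop
  simp only [← form_mul_tmul, ← map_sw_of_isLinearMap i, sw_mul_antipode]
  rw [← TensorProduct.smul_tmul', map_smul, σ.form_one_left, smul_eq_mul]

/-- σ and σ ∘ (S ⊗ S) are inverses of σ ∘ (S ⊗ id) on opposite sides. -/
theorem form_antipode_antipode (h m : H) : σ.form (𝑺 h ⊗ₜ 𝑺 m) = σ.form (h ⊗ₜ m) := by
  have e1 : toConv (σ.form ∘ₗ TensorProduct.map 𝑺 𝑺) * toConv (σ.form ∘ₗ 𝑺.rTensor H) = 1 := by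
    ext h m
    simp only [TensorProduct.AlgebraTensorModule.curry_apply, LinearMap.restrictScalars_self,
      TensorProduct.curry_apply]
    refine (convMul_tmul_eq_sw _ _ _ _).trans ?_
    have i : IsLinearMap k fun z => σ.form (𝑺 h ⊗ₜ z) := by fun_prop
    have e := map_sw_of_isLinearMap i m fun x y => 𝑺 x * y
    simp only [form_tmul_mul] at e
    simp (disch := fun_prop) only [sw_antipode] at e
    simp only [LinearMap.comp_apply, TensorProduct.map_tmul, LinearMap.rTensor_tmul]
    rw [sw_comm]
    simp only [mul_comm (σ.form (𝑺 _ ⊗ₜ 𝑺 _))]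
    rw [← e, sw_antipode_mul, TensorProduct.tmul_smul, map_smul, σ.form_one_right]
    simp [mul_comm]
  have e2 : toConv (σ.form ∘ₗ 𝑺.rTensor H) * toConv σ.form = 1 := by
    ext h m
    simp only [TensorProduct.AlgebraTensorModule.curry_apply, LinearMap.restrictScalars_self,
      TensorProduct.curry_apply]
    refine (convMul_tmul_eq_sw _ _ _ _).trans ?_
    simpa [mul_comm] using σ.antipode_form_conv h m
  exact congrArg (fun f => f (h ⊗ₜ m)) (left_inv_eq_right_inv e1 e2)

theorem u_apply (h : H) : σ.u h = sw k h fun x y => σ.form (y ⊗ₜ 𝑺 x) := by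
  simp only [u, LinearMap.comp_apply, map_comul, map_sw]
  simp

theorem v_apply (h : H) : σ.v h = sw k h fun x y => σ.form (x ⊗ₜ 𝑺 y) := by
  rw [v, LinearMap.comp_apply, u_apply, sw_antipode (by fun_prop) (by fun_prop)]
  simp only [form_antipode_antipode]

theorem u_antipode (h : H) : σ.u (𝑺 h) = σ.v h := rfl

theorem v_antipode (h : H) : σ.v (𝑺 h) = σ.u h := by
  rw [v_apply, u_apply, sw_antipode (by fun_prop) (by fun_prop)]
  simp only [form_antipode_antipode]

/-- The commutation axiom at the pair (x₂, S(x₁)): one side assembles u, on the other the antipode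
cancels. -/
theorem sw_u_mul_antipode (x : H) :
    (sw k x fun a r => sw k r fun e d => σ.u e • (d * 𝑺 a)) = σ.u x • (1 : H) := by
  have e := sw_congr (k := k) (fun a b => σ.mul_comm_form_eq_sw b (𝑺 a)) x
  simp (disch := fun_prop) only [sw_antipode] at e
  rw [sw_swap_assoc (by fun_prop) (by fun_prop) (by fun_prop) (by fun_prop),
    sw_swap_assoc (by fun_prop) (by fun_prop) (by fun_prop) (by fun_prop)] at e
  have i1 : ∀ x : H, IsLinearMap k fun c : k => c • x := fun x => by fun_prop
  simp only [u_apply, map_sw_of_isLinearMap (i1 _)]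
  refine Eq.trans ?_ (e.symm.trans ?_)
  · refine sw_congr (fun p r => ?_) x
    exact sw_assoc (f := fun q c d => σ.form (c ⊗ₜ 𝑺 q) • (d * 𝑺 p)) (by fun_prop) (by fun_prop)
      (by fun_prop) r
  · refine sw_congr (fun p r => ?_) x
    exact sw_cancel_left sw_antipode_mul (by fun_prop) (by fun_prop)
      (fun z d => σ.form (d ⊗ₜ 𝑺 p) • z) (by fun_prop) (by fun_prop) r

/-- The square of the antipode is conjugation by `u`. -/
theorem sw_u_antipode_antipode (h : H) :
    (sw k h fun x y => σ.u y • 𝑺 (𝑺 x)) = sw k h fun x y => σ.u x • y := by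
  symm
  calc _ = sw k h fun x y => sw k y fun a r => sw k r fun e d => σ.u e • (d * (𝑺 a * 𝑺 (𝑺 x))) := by
        rw [sw_cancel_left sw_antipode_mul_antipode (by fun_prop) (by fun_prop)
          (fun z r => sw k r fun e d => σ.u e • (d * z)) (by fun_prop) (by fun_prop) h]
        simp only [mul_one]
    _ = sw k h fun x y => (sw k y fun a r => sw k r fun e d => σ.u e • (d * 𝑺 a)) * 𝑺 (𝑺 x) := by
        have i : ∀ x : H, IsLinearMap k fun z => z * x := fun x => by fun_prop
        simp only [map_sw_of_isLinearMap (i _), smul_mul_assoc, mul_assoc]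
    _ = _ := by simp only [sw_u_mul_antipode, smul_mul_assoc, one_mul]

/-- The convolution inverse of `u`. -/
def uInv : H →ₗ[k] k :=
  IsLinearMap.mk' (R := k) (fun h => sw k h fun x y => σ.form (𝑺 (𝑺 y) ⊗ₜ x)) (by fun_prop)

theorem uInv_apply (h : H) : σ.uInv h = sw k h fun x y => σ.form (𝑺 (𝑺 y) ⊗ₜ x) := rfl

theorem sw_u_form (h : H) :
    (sw k h fun x r => sw k r fun p q => σ.u p * σ.form (q ⊗ₜ x)) = counit (R := k) h := by
  have i : ∀ c : k, IsLinearMap k fun z : k => z * c := fun x => by fun_prop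
  simp only [u_apply, map_sw_of_isLinearMap (i _)]
  calc _ = sw k h fun x r => sw k r fun p1 r => sw k r fun p2 q =>
          σ.form (p2 ⊗ₜ 𝑺 p1) * σ.form (q ⊗ₜ x) := by
        refine sw_congr (fun x r => ?_) h
        exact sw_assoc (f := fun a b q => σ.form (b ⊗ₜ 𝑺 a) * σ.form (q ⊗ₜ x)) (by fun_prop)
          (by fun_prop) (by fun_prop) r
    _ = sw k h fun x r => sw k r fun p r => σ.form (r ⊗ₜ (x * 𝑺 p)) := by
        simp only [form_tmul_mul]
    _ = _ := by
        rw [sw_cancel_left sw_mul_antipode (by fun_prop) (by fun_prop)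
          (fun z r => σ.form (r ⊗ₜ z)) (by fun_prop) (by fun_prop), form_one_right]

theorem u_mul_uInv : toConv σ.u * toConv σ.uInv = 1 := by
  ext h
  rw [convMul_apply_eq_sw, LinearMap.convOne_apply, Algebra.algebraMap_self, RingHom.id_apply,
    ← σ.sw_u_form]
  have i : ∀ c : k, IsLinearMap k fun z : k => c * z := fun x => by fun_prop
  simp only [uInv_apply, map_sw_of_isLinearMap (i _)]
  rw [← sw_assoc (f := fun x p q => σ.u x * σ.form (𝑺 (𝑺 q) ⊗ₜ p)) (by fun_prop) (by fun_prop)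
    (by fun_prop), ← sw_assoc (f := fun x p q => σ.u p * σ.form (q ⊗ₜ x)) (by fun_prop)
    (by fun_prop) (by fun_prop)]
  refine sw_congr (fun e q => ?_) h
  have j : IsLinearMap k fun z : H => σ.form (𝑺 (𝑺 q) ⊗ₜ z) := by fun_prop
  have := congrArg (IsLinearMap.mk' _ j) (σ.sw_u_antipode_antipode e)
  simpa only [map_sw, map_smul, IsLinearMap.mk'_apply, form_antipode_antipode, smul_eq_mul]
    using this.symm

theorem uInv_mul_u : toConv σ.uInv * toConv σ.u = 1 := by
  ext h
  rw [convMul_apply_eq_sw, LinearMap.convOne_apply, Algebra.algebraMap_self, RingHom.id_apply,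
    ← σ.sw_u_form]
  have i : ∀ c : k, IsLinearMap k fun z : k => z * c := fun x => by fun_prop
  simp only [uInv_apply, map_sw_of_isLinearMap (i _)]
  rw [sw_assoc (f := fun p q y => σ.form (𝑺 (𝑺 q) ⊗ₜ p) * σ.u y) (by fun_prop) (by fun_prop)
    (by fun_prop)]
  refine sw_congr (fun p r => ?_) h
  have j : IsLinearMap k fun z : H => σ.form (z ⊗ₜ p) := by fun_prop
  have := congrArg (IsLinearMap.mk' _ j) (σ.sw_u_antipode_antipode r)
  simpa only [map_sw, map_smul, IsLinearMap.mk'_apply, smul_eq_mul, mul_comm] using this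

/-- Apply v to the conjugation formula for S², using v ∘ S² = v. -/
theorem u_mul_v : toConv σ.u * toConv σ.v = toConv σ.v * toConv σ.u := by
  ext h
  have := congrArg σ.v (σ.sw_u_antipode_antipode h)
  simp only [map_sw, map_smul, smul_eq_mul, v_antipode, u_antipode] at this
  simp only [convMul_apply_eq_sw, ← this, mul_comm]

/-- The coquasitriangular structure `h ⊗ l ↦ σ⁻¹(l ⊗ h)`. -/
def reverse : Coquasitriangular k H where
  form := σ.form ∘ₗ 𝑺.rTensor H ∘ₗ (TensorProduct.comm k H H).toLinearMap
  form_mul_left h l := by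
    ext m
    rw [convMul_apply_eq_sw]
    have := σ.form_tmul_mul (𝑺 m) h l
    rw [sw_antipode (by fun_prop) (by fun_prop)] at this
    simpa [mul_comm] using this
  form_mul_right l m := by
    ext h
    rw [convMul_apply_eq_sw]
    have := σ.form_mul_tmul (𝑺 m) (𝑺 l) h
    simpa [antipode_mul_antidistrib] using this
  form_one_right h := by simpa using σ.form_one_left h
  form_one_left h := by simpa using σ.form_one_right (𝑺 h)
  mul_comm_form h l := by
    refine (rid_map_comul _ _ _).trans (Eq.trans ?_ (lid_map_comul _ _ _).symm)
    let C := (TensorProduct.comm k H H).toLinearMap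
    let s := toConv (Algebra.linearMap k H ∘ₗ σ.form ∘ₗ C)
    let r := toConv (Algebra.linearMap k H ∘ₗ σ.form ∘ₗ 𝑺.rTensor H ∘ₗ C)
    -- The axiom for σ with its arguments swapped; convolving with r = s⁻¹ on both sides gives the
    -- axiom for the reversed form.
    have e0 : toConv (LinearMap.mul' k H) * s = s * toConv (LinearMap.mul' k H ∘ₗ C) := by
      ext h l
      refine (convMul_tmul_eq_sw _ _ _ _).trans (Eq.trans ?_ (convMul_tmul_eq_sw _ _ _ _).symm)
      have := σ.mul_comm_form_eq_sw l h
      rw [sw_comm, sw_comm l h] at this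
      simpa [s, C, Algebra.algebraMap_eq_smul_one] using this
    have e1 : r * s = 1 := by
      ext h l
      refine (convMul_tmul_eq_sw _ _ _ _).trans ?_
      have := congrArg (algebraMap k H) (σ.antipode_form_conv l h)
      rw [sw_comm, ← Algebra.linearMap_apply, map_sw] at this
      simpa [s, C, r, map_sw] using this
    have e2 : s * r = 1 := by
      ext h l
      refine (convMul_tmul_eq_sw _ _ _ _).trans ?_
      have := congrArg (algebraMap k H) (σ.form_conv_antipode l h)
      rw [sw_comm, ← Algebra.linearMap_apply, map_sw] at this
      simpa [s, C, r, map_sw] using this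
    refine congrArg (fun f => f (h ⊗ₜ l)) (?_ : toConv (LinearMap.mul' k H ∘ₗ C) * r =
      r * toConv (LinearMap.mul' k H))
    calc _ = r * s * toConv (LinearMap.mul' k H ∘ₗ C) * r := by rw [e1, one_mul]
      _ = r * (toConv (LinearMap.mul' k H) * s) * r := by rw [e0, mul_assoc r]
      _ = r * toConv (LinearMap.mul' k H) * (s * r) := by simp only [mul_assoc]
      _ = _ := by rw [e2, mul_one]

end Coquasitriangular

/-! ### Modular elements in the presence of σ. -/

variable {k H : Type*} [Field k] [Ring H] [HopfAlgebra k H]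

local notation "𝑺" => antipode k (A := H)

theorem leftIntegral_mul_of_groupLike {l : Module.Dual k H} {T : H →ₗ[k] H}
    (hST : ∀ h : H, antipode k (T h) = h) (hTS : ∀ h : H, T (antipode k h) = h)
    {b : GroupLike k H} (hb : ∀ h : H, (sw k h fun x y => l x • y) = l h • (b : H)) (h m : H) :
    (sw k h fun x y => l (m * x) • y) = sw k m fun p q => l (p * h) • (T q * b) := by
  symm
  calc (sw k m fun p q => l (p * h) • (T q * b))
      = sw k m fun p q => T q * (sw k (p * h) fun x y => l x • y) := by simp [hb]
    _ = sw k m fun p q => sw k p fun c d => sw k h fun x y => l (c * x) • (T q * d * y) := by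
        refine sw_congr (fun p q => ?_) m
        rw [sw_mul (by fun_prop) (by fun_prop)]
        have e : IsLinearMap k fun z => T q * z := by fun_prop
        simp only [map_sw_of_isLinearMap e, mul_smul_comm, mul_assoc]
    _ = sw k m fun c r => sw k r fun d q => sw k h fun x y => l (c * x) • (T q * d * y) :=
        sw_assoc (by fun_prop) (by fun_prop) (by fun_prop) m
    _ = sw k h fun x y => l (m * x) • (1 * y) :=
        sw_cancel_right (sw_antipodeInv_mul hST hTS)
          (fun c z => sw k h fun x y => l (c * x) • (z * y)) (by fun_prop) (by fun_prop) m
    _ = _ := by simp only [one_mul]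

theorem toDual_injective : Function.Injective (toDual (k := k) (H := H)) := fun _ _ h =>
  AlgHom.toLinearMap_injective (toConv_injective h)

theorem toDual_mul_antipode (f : H →ₐ[k] k) :
    toDual f * toConv (f.toLinearMap ∘ₗ 𝑺) = 1 := by
  ext h
  have := congrArg f.toLinearMap (sw_mul_antipode (k := k) h)
  rw [map_sw, map_smul] at this
  rw [convMul_apply_eq_sw]
  simpa [toDual] using this

theorem antipode_mul_toDual (f : H →ₐ[k] k) :
    toConv (f.toLinearMap ∘ₗ 𝑺) * toDual f = 1 := by
  ext h
  have := congrArg f.toLinearMap (sw_antipode_mul (k := k) h)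
  rw [map_sw, map_smul] at this
  rw [convMul_apply_eq_sw]
  simpa [toDual] using this

theorem isUnit_toDual (f : H →ₐ[k] k) : IsUnit (toDual f) :=
  ⟨⟨toDual f, _, toDual_mul_antipode f, antipode_mul_toDual f⟩, rfl⟩

namespace Coquasitriangular

variable (σ : Coquasitriangular k H)

theorem betaOf_mul_betaOf (g g' : GroupLike k H) :
    toDual (σ.betaOf g) * toDual (σ.betaOf g') = toDual (σ.betaOf (g * g')) := by
  ext h
  rw [convMul_apply_eq_sw]
  exact (σ.form_mul_tmul g g' h).symm

theorem toDual_betaOf_one : toDual (σ.betaOf 1) = 1 := by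
  ext h
  exact σ.form_one_left h

theorem toDual_alphaOf_one : toDual (σ.alphaOf 1) = 1 := by
  ext h
  have := σ.form_one_right h
  simpa [toDual, alphaOf] using this

theorem v_mul_betaOf {l : Module.Dual k H} (hl : l ∈ leftIntegral k H) (hl0 : l ≠ 0)
    {b : GroupLike k H} (hb : ∀ h : H, (sw k h fun x y => l x • y) = l h • (b : H))
    {χ : H ≃ₐ[k] H} (hχ : IsFrobeniusAut χ) :
    toConv σ.v * toDual (σ.betaOf b) = toConv σ.u * toDual (counitComp χ) := by
  obtain ⟨T, hST, hTS⟩ := exists_antipode_inverse hl hl0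
  ext m
  simp only [convMul_apply_eq_sw]
  -- `A` is v * β_b in disguise: split σ(S⁻¹(r₁) b, r₂) by multiplicativity and use σ(S⁻¹x, y) =
  -- σ(x, Sy).
  let A : H → k := fun r => sw k r fun p q => σ.form ((T p * b) ⊗ₜ q)
  have hA : IsLinearMap k A := by
    simp only [A]
    fun_prop
  have i1 : ∀ c : k, IsLinearMap k fun z : k => c * z := fun x => by fun_prop
  have i2 : ∀ c : k, IsLinearMap k fun z : k => z * c := fun x => by fun_prop
  -- l applied to the commutation axiom at (h, m). The grouplike formula rewrites one side, the left
  -- integral formula and χ the other; h stays free so that nondegeneracy can remove it.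
  have key : ∀ h, (sw k m fun p r => l (p * h) * A r) =
      sw k (χ m) fun p q => l (q * h) * σ.v (𝑺 p) := fun h => by
    have e := congrArg l (σ.mul_comm_form_eq_sw h m)
    simp only [map_sw, map_smul, smul_eq_mul] at e
    calc _ = sw k m fun p1 r => sw k r fun p2 q =>
            l (p1 * h) * σ.form ((T p2 * b) ⊗ₜ q) := by
          simp only [A, map_sw_of_isLinearMap (i1 _)]
      _ = sw k m fun p q => sw k p fun p1 p2 => l (p1 * h) * σ.form ((T p2 * b) ⊗ₜ q) :=
          (sw_assoc (by fun_prop) (by fun_prop) (by fun_prop) m).symm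
      _ = sw k m fun p q => sw k h fun x y => σ.form (y ⊗ₜ q) * l (p * x) := by
          refine sw_congr (fun p q => ?_) m
          have j : IsLinearMap k fun z : H => σ.form (z ⊗ₜ q) := by fun_prop
          have := congrArg (IsLinearMap.mk' _ j) (leftIntegral_mul_of_groupLike hST hTS hb h p)
          simp only [map_sw, map_smul, IsLinearMap.mk'_apply, smul_eq_mul] at this
          simp only [← this, mul_comm]
      _ = sw k h fun x y => sw k m fun p q => σ.form (x ⊗ₜ p) * l (y * q) := by
          rw [sw_comm, e]
      _ = sw k h fun x y => sw k y fun c d => σ.form (x ⊗ₜ 𝑺 c) * l (d * m) := by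
          refine sw_congr (fun x y => ?_) h
          have j : IsLinearMap k fun z : H => σ.form (x ⊗ₜ z) := by fun_prop
          have := congrArg (IsLinearMap.mk' _ j) (leftIntegral_mul hl m y)
          simp only [map_sw, map_smul, IsLinearMap.mk'_apply, smul_eq_mul] at this
          simp only [mul_comm (σ.form _), this]
      _ = sw k h fun e d => sw k e fun x c => σ.form (x ⊗ₜ 𝑺 c) * l (d * m) :=
          (sw_assoc (by fun_prop) (by fun_prop) (by fun_prop) h).symm
      _ = sw k h fun e d => l (χ m * d) * σ.v e := by
          refine sw_congr (fun e d => ?_) h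
          rw [← hχ l hl, v_apply, mul_comm, map_sw_of_isLinearMap (i2 _)]
      _ = _ := by
          have := congrArg σ.v (leftIntegral_mul hl h (χ m))
          simpa only [map_sw, map_smul, smul_eq_mul] using this
  have e1 : (sw k m fun p r => A r • p) = sw k (χ m) fun p q => σ.v (𝑺 p) • q := by
    rw [← sub_eq_zero]
    refine eq_zero_of_forall_mul_right hl hl0 fun h => ?_
    have j : IsLinearMap k fun z : H => l (z * h) := by fun_prop
    simpa only [sub_mul, map_sub, map_sw_of_isLinearMap j, smul_mul_assoc, map_smul, smul_eq_mul,
      sub_eq_zero, mul_comm] using key h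
  have e2 := congrArg (counit (R := k)) e1
  simp only [map_sw, map_smul, smul_eq_mul, v_antipode] at e2
  have e4 : A m = σ.u (χ m) := by
    have c1 := sw_counit_right (k := k) (f := fun x => σ.u x) (by fun_prop) (χ m)
    have c2 := sw_counit_left (k := k) hA m
    refine c2.symm.trans (Eq.trans ?_ c1)
    simpa only [smul_eq_mul, mul_comm (counit (R := k) _)] using e2
  have e5 : ∀ x, σ.u (T (T x)) = σ.u x := fun x => by
    conv_rhs => rw [← hST x, ← hST (T x), u_antipode, v_antipode]
  rw [hχ.apply_eq hl hl0 hTS, map_sw] at e4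
  simp only [map_smul, e5, smul_eq_mul] at e4
  refine Eq.trans ?_ (e4.trans (sw_congr (fun x y => mul_comm _ _) m))
  calc _ = sw k m fun e d => sw k e fun p c => σ.form (p ⊗ₜ 𝑺 c) * σ.form ((b : H) ⊗ₜ d) := by
        refine sw_congr (fun e d => ?_) m
        rw [← map_sw_of_isLinearMap (i2 _), ← v_apply]
        rfl
    _ = sw k m fun p r => sw k r fun c d => σ.form (p ⊗ₜ 𝑺 c) * σ.form ((b : H) ⊗ₜ d) :=
        sw_assoc (by fun_prop) (by fun_prop) (by fun_prop) m
    _ = A m := by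
        refine sw_congr (fun p r => ?_) m
        rw [form_mul_tmul]
        refine sw_congr (fun c d => ?_) r
        rw [← σ.form_antipode_antipode (T p), hST]

theorem v_eq {a : GroupLike k H} (hH : IsCoFrobenius k H) (ha : IsModularElement a)
    {χ : H ≃ₐ[k] H} (hχ : IsFrobeniusAut χ) :
    toConv σ.v = toConv σ.u * (toDual (counitComp χ) * toDual (σ.betaOf a)) := by
  obtain ⟨l, hl, hl0⟩ := exists_leftIntegral_ne_zero hH
  rw [← mul_assoc, ← σ.v_mul_betaOf hl hl0 (isModularElement_iff.1 ha l hl) hχ, mul_assoc,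
    betaOf_mul_betaOf, inv_mul_cancel, toDual_betaOf_one, mul_one]

theorem reverse_form (h l : H) : σ.reverse.form (h ⊗ₜ l) = σ.form (𝑺 l ⊗ₜ h) := rfl

theorem reverse_v : σ.reverse.v = σ.uInv := by
  ext h
  simp only [v_apply, uInv_apply, reverse_form]

theorem reverse_u_apply (h : H) : σ.reverse.u h = σ.uInv (𝑺 h) := by
  rw [← reverse_v, v_antipode]

/-- The relation u⁻¹ * u = ε read at S(h). -/
theorem v_mul_reverse_u : toConv σ.v * toConv σ.reverse.u = 1 := by
  ext h
  have := congrArg (fun f => f (𝑺 h)) σ.uInv_mul_u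
  simp only [convMul_apply_eq_sw] at this
  rw [sw_antipode (by fun_prop) (by fun_prop)] at this
  rw [convMul_apply_eq_sw]
  simpa [reverse_u_apply, u_antipode, mul_comm] using this

theorem v_mul_uInv : toConv σ.v * toConv σ.uInv = toConv σ.uInv * toConv σ.v := by
  calc _ = toConv σ.uInv * toConv σ.u * toConv σ.v * toConv σ.uInv := by rw [uInv_mul_u, one_mul]
    _ = toConv σ.uInv * toConv σ.v * (toConv σ.u * toConv σ.uInv) := by
        rw [mul_assoc (toConv σ.uInv), u_mul_v]
        simp only [mul_assoc]
    _ = _ := by rw [u_mul_uInv, mul_one]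

/-- σ and its reverse give two expressions for v * u⁻¹ with the same α and a, so the unit α cancels.
-/
theorem alphaOf_eq_betaOf {a : GroupLike k H} (hH : IsCoFrobenius k H) (ha : IsModularElement a)
    {χ : H ≃ₐ[k] H} (hχ : IsFrobeniusAut χ) : σ.alphaOf a = σ.betaOf a := by
  have e1 : toConv σ.v * toConv σ.uInv = toDual (counitComp χ) * toDual (σ.betaOf a) := by
    rw [v_mul_uInv, σ.v_eq hH ha hχ, ← mul_assoc, uInv_mul_u, one_mul]
  have e2 : toConv σ.v * toConv σ.uInv = toDual (counitComp χ) * toDual (σ.reverse.betaOf a) := by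
    rw [← reverse_v, σ.reverse.v_eq hH ha hχ, ← mul_assoc, v_mul_reverse_u, one_mul]
  have e3 := toDual_injective ((isUnit_toDual _).mul_left_cancel (e1.symm.trans e2))
  rw [e3]
  ext h
  change σ.form (h ⊗ₜ 𝑺 (a : H)) = σ.form (𝑺 h ⊗ₜ (a : H))
  rw [← form_antipode_antipode, a.isGroupLikeElem_val.antipode_antipode]

theorem isUnit_u : IsUnit (toConv σ.u) := ⟨⟨_, _, σ.u_mul_uInv, σ.uInv_mul_u⟩, rfl⟩

theorem inverse_u_mul_v {a : GroupLike k H} (hH : IsCoFrobenius k H) (ha : IsModularElement a)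
    {χ : H ≃ₐ[k] H} (hχ : IsFrobeniusAut χ) :
    Ring.inverse (toConv σ.u) * toConv σ.v =
      toDual (counitComp χ) * toDual (σ.alphaOf a) := by
  rw [σ.v_eq hH ha hχ, Ring.inverse_mul_cancel_left _ _ σ.isUnit_u, σ.alphaOf_eq_betaOf hH ha hχ]

end Coquasitriangular

end CoFrobenius

end

/-! ### The main theorem. -/

theorem mainTheorem4 {k H : Type*} [Field k] [Ring H] [HopfAlgebra k H]
    (hH : CoFrobenius.IsCoFrobenius k H) :
    (∃! a : GroupLike k H, CoFrobenius.IsModularElement a) ∧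
    (∃! χ : H ≃ₐ[k] H, CoFrobenius.IsFrobeniusAut χ) ∧
    ∀ (a : GroupLike k H) (χ : H ≃ₐ[k] H),
      CoFrobenius.IsModularElement a → CoFrobenius.IsFrobeniusAut χ →
      ∀ σ : CoFrobenius.Coquasitriangular k H,
        IsUnit (toConv σ.u) ∧
        IsUnit (CoFrobenius.toDual (CoFrobenius.counitComp χ)) ∧
        σ.alphaOf a = σ.betaOf a ∧
        (a = 1 →
          Ring.inverse (toConv σ.u) * toConv σ.v =
            CoFrobenius.toDual (CoFrobenius.counitComp χ) ∧
          ∀ τ : CoFrobenius.Coquasitriangular k H,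
            Ring.inverse (toConv τ.u) * toConv τ.v =
              Ring.inverse (toConv σ.u) * toConv σ.v) ∧
        (σ.u ∘ₗ HopfAlgebra.antipode k = σ.u ↔
          CoFrobenius.toDual (σ.alphaOf a) =
            Ring.inverse (CoFrobenius.toDual (CoFrobenius.counitComp χ))) := by
  obtain ⟨l, hl, hl0⟩ := CoFrobenius.exists_leftIntegral_ne_zero hH
  refine ⟨CoFrobenius.existsUnique_isModularElement hl hl0,
    CoFrobenius.existsUnique_isFrobeniusAut hl hl0, fun a χ ha hχ σ => ?_⟩
  have hα := CoFrobenius.isUnit_toDual (CoFrobenius.counitComp χ)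
  refine ⟨σ.isUnit_u, hα, σ.alphaOf_eq_betaOf hH ha hχ, fun h1 => ?_, ?_⟩
  · have key : ∀ τ : CoFrobenius.Coquasitriangular k H, Ring.inverse (toConv τ.u) * toConv τ.v =
        CoFrobenius.toDual (CoFrobenius.counitComp χ) := fun τ => by
      rw [τ.inverse_u_mul_v hH ha hχ, h1, τ.toDual_alphaOf_one, mul_one]
    exact ⟨key σ, fun τ => (key τ).trans (key σ).symm⟩
  · have hv : toConv σ.v = toConv σ.u * (CoFrobenius.toDual (CoFrobenius.counitComp χ) *
        CoFrobenius.toDual (σ.alphaOf a)) := by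
      rw [σ.alphaOf_eq_betaOf hH ha hχ, ← σ.v_eq hH ha hχ]
    constructor
    · intro h
      have h : toConv σ.v = toConv σ.u := congrArg toConv h
      rw [h] at hv
      have := σ.isUnit_u.mul_left_cancel ((mul_one _).trans hv)
      rw [← mul_one (Ring.inverse _), this, Ring.inverse_mul_cancel_left _ _ hα]
    · intro h
      rw [h, Ring.mul_inverse_cancel _ hα, mul_one] at hv
      exact toConv_injective hv
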